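/- Let $d\ge 0$ and let $\Omega_1,\dots,\Omega_d$ be finite sets. A weighted $d$-partite complex $X$ is a probability distribution $\Pi$ on $\Omega_1\times\cdots\times\Omega_d$; $\mathbb E$ and $\|f\|_p=\mathbb E[|f|^p]^{1/p}$ refer to $x\sim\Pi$. For $S\subseteq[d]$, a face $x_S$ is the projection to the coordinates in $S$ of a tuple of positive probability. Its link $X_{x_S}$ is the distribution $\Pi$ conditioned on the $S$-coordinates being $x_S$, and $\|f|_{x_S}\|_2$ is the $2$-norm of $f$ under this conditional distribution. For $\gamma\ge 0$, $X$ is a $\gamma$-product if for every face $x_S$ and all distinct $i,j\in[d]\setminus S$, the operator $A_{i,j}g(y_j)=\mathbb E[g(x_i)\mid x_j=y_j]$ of the link $X_{x_S}$ satisfies $\|A_{i,j}g-\mathbb E[g(x_i)]\|_2\le\gamma\|g\|_2$ for all $g:\Omega_i\to\mathbb R$ (norms with respect to the marginals of the link), i.e. $\lambda_2(A_{i,j})\le\gamma$. For $f:X\to\mathbb R$ put $$f^{=S}(y)=\sum_{T\subseteq S}(-1)^{|S\setminus T|}\,\mathbb E[f(x)\mid x_T=y_T],\qquad f^{\le i}=\sum_{|S|\le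 i}f^{=S},\qquad M_i(f)=\max_{|S|\le i,\;x_S}\|f|_{x_S}\|_2 ,$$ the maximum being over all faces $x_S$ with $|S|\le i$. \textbf{Theorem (global hypercontractivity, Bonami form).} There are universal constants $C,K\in\mathbb N$ such that the following holds. Let $q\ge 2$ be an even integer and let $X$ be a $d$-partite $\gamma$-product with $0\le\gamma\le 2^{-Cqd}$. Then for every $0\le i\le d$ and every $f:X\to\mathbb R$, $$\|f^{\le i}\|_q^q\;\le\;(500q)^{qi}\,\|f^{\le i}\|_2^2\,M_i(f)^{q-2}\;+\;c\,\gamma\,\|f\|_2^2\,M_i(f)^{q-2},\qquad c=q^{Kqi}\,2^{Kdq},$$ and $$\|f^{\le i}\|_q\;\le\;(500q)^{i}\,\|f\|_2^{2/q}\,M_i(f)^{1-2/q}.$$ (Here $0^0=1$.) -/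

import Mathlib

/-- A weighted `d`-partite complex (partite hypergraph) with finite colour classes `Ω 1, …, Ω d`,
given by its distribution over the tuples `x = (x₁, …, x_d)`. The top faces are the tuples of
positive weight. -/
structure PartiteComplex (d : ℕ) (Ω : Fin d → Type*) [∀ k, Fintype (Ω k)] where
  /-- the probability of a tuple -/
  weight : (∀ k, Ω k) → ℝ
  weight_nonneg : ∀ x, 0 ≤ weight x
  weight_sum : ∑ x, weight x = 1

namespace PartiteComplex

/-- `x` and `y` have the same projection to the coordinates in `S`: `x_S = y_S`. -/
def Agree {d : ℕ} {Ω : Fin d → Type*} (S : Finset (Fin d)) (x y : ∀ k, Ω k) : Prop :=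
  ∀ k ∈ S, x k = y k

open Classical in
/-- `Pr[x_S = y_S]`, the weight of the projection `y_S` in the marginal `X[S]`. -/
noncomputable def marginal {d : ℕ} {Ω : Fin d → Type*} [∀ k, Fintype (Ω k)]
    (X : PartiteComplex d Ω) (S : Finset (Fin d)) (y : ∀ k, Ω k) : ℝ :=
  ∑ x, if Agree S x y then X.weight x else 0

open Classical in
theorem marginal_pos {d : ℕ} {Ω : Fin d → Type*} [∀ k, Fintype (Ω k)]
    (X : PartiteComplex d Ω) (S : Finset (Fin d)) {y : ∀ k, Ω k} (hy : 0 < X.weight y) :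
    0 < X.marginal S y := by
  unfold marginal
  refine Finset.sum_pos' (fun x _ => ?_) ⟨y, Finset.mem_univ y, ?_⟩
  · split_ifs
    · exact X.weight_nonneg x
    · exact le_rfl
  · have h : Agree S y y := fun _ _ => rfl
    rw [if_pos h]
    exact hy

open Classical in
/-- The link of the face `y_S`: the distribution of `x` conditioned on `x_S = y_S`. It is kept as a
distribution over full tuples, whose `S`-coordinates are constantly `y_S`, so that the restriction
`f|_{y_S}` is `f` itself, seen under this distribution. Every face `y_S` of `X` is the projection
of a tuple `y` of positive weight. -/
noncomputable def link {d : ℕ} {Ω : Fin d → Type*} [∀ k, Fintype (Ω k)]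
    (X : PartiteComplex d Ω) (S : Finset (Fin d)) (y : ∀ k, Ω k) (hy : 0 < X.weight y) :
    PartiteComplex d Ω where
  weight x := (if Agree S x y then X.weight x else 0) / X.marginal S y
  weight_nonneg x := by
    refine div_nonneg ?_ (X.marginal_pos S hy).le
    split_ifs
    · exact X.weight_nonneg x
    · exact le_rfl
  weight_sum := by
    rw [← Finset.sum_div]
    exact div_self (X.marginal_pos S hy).ne'

/-- `𝔼[f]`. -/
noncomputable def expect {d : ℕ} {Ω : Fin d → Type*} [∀ k, Fintype (Ω k)]
    (X : PartiteComplex d Ω) (f : (∀ k, Ω k) → ℝ) : ℝ :=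
  ∑ x, X.weight x * f x

/-- `‖f‖_p = 𝔼[|f|^p]^{1/p}`. -/
noncomputable def lpNorm {d : ℕ} {Ω : Fin d → Type*} [∀ k, Fintype (Ω k)]
    (X : PartiteComplex d Ω) (p : ℝ) (f : (∀ k, Ω k) → ℝ) : ℝ :=
  (X.expect fun x => |f x| ^ p) ^ (1 / p)

open Classical in
/-- The averaging operator `E_T f (y) = 𝔼[f(x) | x_T = y_T]`, as a function of the full tuple. -/
noncomputable def avg {d : ℕ} {Ω : Fin d → Type*} [∀ k, Fintype (Ω k)]
    (X : PartiteComplex d Ω) (T : Finset (Fin d)) (f : (∀ k, Ω k) → ℝ) (y : ∀ k, Ω k) : ℝ :=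
  (∑ x, if Agree T x y then X.weight x * f x else 0) / X.marginal T y

/-- `λ₂(A_{i,j}) ≤ γ` for the bipartite walk `A_{i,j} g (y_j) = 𝔼[g(x_i) | x_j = y_j]` between the
colours `i` and `j` (the largest singular value on the complement of the constants): the operator
norm of `A_{i,j} - Π_{i,j}` from `L²(X[i])` to `L²(X[j])` is at most `γ`, where `Π_{i,j} g` is the
constant `𝔼[g(x_i)]`. The norms in the marginals are those of the functions lifted to tuples. -/
def WalkBound {d : ℕ} {Ω : Fin d → Type*} [∀ k, Fintype (Ω k)]
    (X : PartiteComplex d Ω) (i j : Fin d) (γ : ℝ) : Prop :=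
  ∀ g : Ω i → ℝ,
    X.lpNorm 2 (fun y => X.avg {j} (fun x => g (x i)) y - X.expect fun x => g (x i)) ≤
      γ * X.lpNorm 2 (fun x => g (x i))

/-- `X` is a `γ`-product: in every link, every bipartite walk between two distinct colours outside
the face has `λ₂ ≤ γ` (such links automatically have co-dimension at least `2`). -/
def IsGammaProduct {d : ℕ} {Ω : Fin d → Type*} [∀ k, Fintype (Ω k)]
    (X : PartiteComplex d Ω) (γ : ℝ) : Prop :=
  ∀ (S : Finset (Fin d)) (y : ∀ k, Ω k) (hy : 0 < X.weight y) (i j : Fin d),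
    i ∉ S → j ∉ S → i ≠ j → (X.link S y hy).WalkBound i j γ

/-- The Efron–Stein component `f^{=S} = ∑_{T ⊆ S} (-1)^{|S \ T|} E_T f`. -/
noncomputable def efronStein {d : ℕ} {Ω : Fin d → Type*} [∀ k, Fintype (Ω k)]
    (X : PartiteComplex d Ω) (f : (∀ k, Ω k) → ℝ) (S : Finset (Fin d)) (x : ∀ k, Ω k) : ℝ :=
  ∑ T ∈ S.powerset, (-1) ^ (S \ T).card * X.avg T f x

/-- `f^{≤ i} = ∑_{|S| ≤ i} f^{=S}`. -/
noncomputable def lowDegree {d : ℕ} {Ω : Fin d → Type*} [∀ k, Fintype (Ω k)]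
    (X : PartiteComplex d Ω) (f : (∀ k, Ω k) → ℝ) (i : ℕ) (x : ∀ k, Ω k) : ℝ :=
  ∑ S with S.card ≤ i, X.efronStein f S x

/-- `max_{|S| ≤ i, x_S} ‖f|_{x_S}‖₂`, over all faces `x_S` of `X` with at most `i` coordinates (a
finite non-empty family, so that the supremum is a maximum). -/
noncomputable def maxLinkNorm {d : ℕ} {Ω : Fin d → Type*} [∀ k, Fintype (Ω k)]
    (X : PartiteComplex d Ω) (f : (∀ k, Ω k) → ℝ) (i : ℕ) : ℝ :=
  ⨆ p : {p : Finset (Fin d) × (∀ k, Ω k) // p.1.card ≤ i ∧ 0 < X.weight p.2},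
    (X.link p.1.1 p.1.2 p.2.2).lpNorm 2 f

end PartiteComplex

/-!
Write `q = 2 k`, `g = f^{≤ i}`, `N = ‖f‖₂` and `M = M_i(f)`. The `q`-th moment of `g` is expanded
into the expectations of products of `q` Efron–Stein components.

*Near independence.* The spectral gaps of all links add up to one bilinear estimate,
`IsGammaProduct.abs_expect_mul_sub_le`: a junta on `T` and a junta on `U` are independent given
the coordinates in `T ∩ U`, up to `4 ^ d * γ` times their norms. Hence a component `f^{=S}` is
nearly orthogonal to every junta on a set that does not contain `S`
(`IsGammaProduct.abs_expect_comp_mul_le`), and Bessel's inequality holds up to a factor `2`. Since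
averages of `f` over at most `i` coordinates are bounded by `M`, all products of components are
bounded by powers of `2 ^ d * M`, so that every error is `2 ^ O(d q) * γ * N² * M ^ (q - 2)`.

*Decoupling the signs.* A product of components in which some coordinate occurs exactly once has
negligible expectation. The absolute values of the remaining products are dominated, pointwise,
by the `q`-th moment of the polynomial `∑ |f^{=S}| z_S`, where the `z_e` are independent biased
signs of mean zero with higher moments at least `1`. Hypercontractivity for these signs
(`sum_prod_filter_cover_le`) bounds this moment by `(72 k) ^ (i k)` times the `k`-th power of the
energy `∑ (f^{=S})²`.

*Moments of the energy.* Given a junta on a set `T` of at most `i k` coordinates, the energy has mean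
at most `2 (12 k) ^ i * M²` (`IsGammaProduct.expect_mul_energy_le`): the components split into
components relative to subsets of `T`, to which Bessel's inequality applies in the links. Integrating
out all but one factor of the energy leaves the mean of the energy, which is nearly `‖g‖₂²`.

The error contains powers `q ^ (q i)`, which are at most exponential in `d q` unless
`(500 q) ^ i ≥ 4 ^ d`. In that case the bound `|g| ≤ 4 ^ d * M` suffices.
-/

open Finset

namespace PartiteComplex

variable {d : ℕ} {Ω : Fin d → Type*}

theorem Agree.symm {S : Finset (Fin d)} {x y : ∀ k, Ω k} (h : Agree S x y) : Agree S y x :=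
  fun k hk => (h k hk).symm

theorem Agree.trans {S : Finset (Fin d)} {x y z : ∀ k, Ω k} (h : Agree S x y)
    (h' : Agree S y z) : Agree S x z := fun k hk => (h k hk).trans (h' k hk)

theorem Agree.mono {S T : Finset (Fin d)} (hST : S ⊆ T) {x y : ∀ k, Ω k} (h : Agree T x y) :
    Agree S x y := fun k hk => h k (hST hk)

theorem agree_congr {S : Finset (Fin d)} {x y : ∀ k, Ω k} (h : Agree S x y) (z : ∀ k, Ω k) :
    Agree S z x ↔ Agree S z y := ⟨fun h' => h'.trans h, fun h' => h'.trans h.symm⟩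

variable [∀ k, Fintype (Ω k)] (X : PartiteComplex d Ω)

/-! ### Expectations and the `L²` norm -/

theorem expect_add (f g : (∀ k, Ω k) → ℝ) :
    X.expect (fun x => f x + g x) = X.expect f + X.expect g := by
  simp only [expect, mul_add, sum_add_distrib]

theorem expect_sub (f g : (∀ k, Ω k) → ℝ) :
    X.expect (fun x => f x - g x) = X.expect f - X.expect g := by
  simp only [expect, mul_sub, sum_sub_distrib]

theorem expect_const_mul (c : ℝ) (f : (∀ k, Ω k) → ℝ) :
    X.expect (fun x => c * f x) = c * X.expect f := by
  simp only [expect, mul_sum]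
  exact sum_congr rfl fun x _ => by ring

theorem expect_sum {ι : Type*} (s : Finset ι) (f : ι → (∀ k, Ω k) → ℝ) :
    X.expect (fun x => ∑ a ∈ s, f a x) = ∑ a ∈ s, X.expect (f a) := by
  simp only [expect, mul_sum]
  exact sum_comm

theorem expect_const (c : ℝ) : X.expect (fun _ => c) = c := by
  simp [expect, ← sum_mul, X.weight_sum]

/-- Only the tuples of positive weight matter for an expectation. -/
theorem expect_mono {f g : (∀ k, Ω k) → ℝ} (h : ∀ x, 0 < X.weight x → f x ≤ g x) :
    X.expect f ≤ X.expect g := by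
  refine sum_le_sum fun x _ => ?_
  rcases (X.weight_nonneg x).eq_or_lt with h0 | h0
  · simp [← h0]
  · exact mul_le_mul_of_nonneg_left (h x h0) h0.le

theorem expect_congr {f g : (∀ k, Ω k) → ℝ} (h : ∀ x, 0 < X.weight x → f x = g x) :
    X.expect f = X.expect g :=
  le_antisymm (X.expect_mono fun x hx => (h x hx).le) (X.expect_mono fun x hx => (h x hx).ge)

theorem expect_nonneg {f : (∀ k, Ω k) → ℝ} (h : ∀ x, 0 < X.weight x → 0 ≤ f x) :
    0 ≤ X.expect f := by
  simpa [expect_const] using X.expect_mono (f := fun _ => 0) h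

/-- The norm of `L²(X)`, as a square root. -/
noncomputable def l2 (f : (∀ k, Ω k) → ℝ) : ℝ := √(X.expect fun x => f x ^ 2)

theorem l2_nonneg (f : (∀ k, Ω k) → ℝ) : 0 ≤ X.l2 f := Real.sqrt_nonneg _

theorem l2_sq (f : (∀ k, Ω k) → ℝ) : X.l2 f ^ 2 = X.expect fun x => f x ^ 2 :=
  Real.sq_sqrt (X.expect_nonneg fun _ _ => sq_nonneg _)

theorem lpNorm_two (f : (∀ k, Ω k) → ℝ) : X.lpNorm 2 f = X.l2 f := by
  rw [lpNorm, l2, Real.sqrt_eq_rpow]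
  congr 2
  funext x
  rw [Real.rpow_two, sq_abs]

/-- Cauchy–Schwarz. -/
theorem abs_expect_mul_le (f g : (∀ k, Ω k) → ℝ) :
    |X.expect fun x => f x * g x| ≤ X.l2 f * X.l2 g := by
  have key : ∀ f : (∀ k, Ω k) → ℝ,
      (X.expect fun x => f x * g x) ≤ X.l2 f * X.l2 g := fun f => by
    have h := Real.sum_mul_le_sqrt_mul_sqrt univ (fun x => √(X.weight x) * f x)
      (fun x => √(X.weight x) * g x)
    simp only [mul_pow, Real.sq_sqrt (X.weight_nonneg _)] at h
    refine le_trans (le_of_eq ?_) h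
    refine sum_congr rfl fun x _ => ?_
    linear_combination (-(f x * g x)) * Real.mul_self_sqrt (X.weight_nonneg x)
  refine abs_le'.2 ⟨key f, ?_⟩
  have h := key fun x => -f x
  have e1 : (X.expect fun x => -f x * g x) = -X.expect fun x => f x * g x := by
    simp [expect, sum_neg_distrib]
  have e2 : X.l2 (fun x => -f x) = X.l2 f := by simp [l2]
  rwa [e1, e2] at h

theorem l2_le_mul {f g : (∀ k, Ω k) → ℝ} {c : ℝ} (hc : 0 ≤ c)
    (h : ∀ x, 0 < X.weight x → |f x| ≤ c * |g x|) : X.l2 f ≤ c * X.l2 g := by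
  refine Real.sqrt_le_iff.2 ⟨mul_nonneg hc (X.l2_nonneg g), ?_⟩
  rw [mul_pow, l2_sq, ← expect_const_mul]
  refine X.expect_mono fun x hx => ?_
  rw [← sq_abs (f x), ← sq_abs (g x), ← mul_pow]
  exact pow_le_pow_left₀ (abs_nonneg _) (h x hx) 2

/-! ### Averaging operators -/

theorem marginal_congr {S : Finset (Fin d)} {x y : ∀ k, Ω k} (h : Agree S x y) :
    X.marginal S x = X.marginal S y := by
  unfold marginal
  refine sum_congr rfl fun z _ => ?_
  classical exact if_congr (agree_congr h z) rfl rfl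

theorem avg_dependsOn (S : Finset (Fin d)) (f : (∀ k, Ω k) → ℝ) :
    DependsOn (X.avg S f) S := by
  intro x y h
  have h : Agree S x y := h
  unfold avg
  rw [X.marginal_congr h]
  congr 1
  refine sum_congr rfl fun z _ => ?_
  classical exact if_congr (agree_congr h z) rfl rfl

theorem marginal_nonneg (S : Finset (Fin d)) (y : ∀ k, Ω k) : 0 ≤ X.marginal S y := by
  classical
  exact sum_nonneg fun x _ => by split_ifs <;> simp [X.weight_nonneg]

theorem avg_congr {S : Finset (Fin d)} {f g : (∀ k, Ω k) → ℝ} {y : ∀ k, Ω k}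
    (h : ∀ x, Agree S x y → f x = g x) : X.avg S f y = X.avg S g y := by
  unfold avg
  congr 1
  refine sum_congr rfl fun x _ => ?_
  split_ifs with hx
  · rw [h x hx]
  · rfl

theorem avg_mul_of_dependsOn {S : Finset (Fin d)} {p : (∀ k, Ω k) → ℝ} (hp : DependsOn p S)
    (f : (∀ k, Ω k) → ℝ) (y : ∀ k, Ω k) :
    X.avg S (fun x => p x * f x) y = p y * X.avg S f y := by
  rw [X.avg_congr (g := fun x => p y * f x) fun x hx => by rw [hp hx]]
  unfold avg
  rw [← mul_div_assoc, mul_sum]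
  congr 1
  refine sum_congr rfl fun x _ => ?_
  split_ifs <;> ring

theorem avg_mono {S : Finset (Fin d)} {f g : (∀ k, Ω k) → ℝ} (h : ∀ x, f x ≤ g x)
    (y : ∀ k, Ω k) : X.avg S f y ≤ X.avg S g y := by
  unfold avg
  refine div_le_div_of_nonneg_right (sum_le_sum fun x _ => ?_) (X.marginal_nonneg S y)
  split_ifs
  · exact mul_le_mul_of_nonneg_left (h x) (X.weight_nonneg x)
  · exact le_rfl

theorem avg_nonneg {S : Finset (Fin d)} {f : (∀ k, Ω k) → ℝ} (h : ∀ x, 0 ≤ f x)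
    (y : ∀ k, Ω k) : 0 ≤ X.avg S f y := by
  refine le_trans (le_of_eq ?_) (X.avg_mono (S := S) h y)
  simp [avg]

/-- A conditional expectation is an expectation in the link. -/
theorem link_expect (S : Finset (Fin d)) (y : ∀ k, Ω k) (hy : 0 < X.weight y)
    (f : (∀ k, Ω k) → ℝ) : (X.link S y hy).expect f = X.avg S f y := by
  unfold expect avg link
  rw [sum_div]
  refine sum_congr rfl fun x _ => ?_
  simp only
  split_ifs <;> ring

/-- The averaging operators are self-adjoint. -/
theorem expect_avg_mul (S : Finset (Fin d)) (f g : (∀ k, Ω k) → ℝ) :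
    (X.expect fun x => X.avg S f x * g x) = X.expect fun x => f x * X.avg S g x := by
  classical
  simp only [expect, avg, sum_div, sum_mul, mul_sum]
  rw [sum_comm]
  refine sum_congr rfl fun x _ => sum_congr rfl fun y _ => ?_
  by_cases h : Agree S x y
  · rw [if_pos h, if_pos h.symm, X.marginal_congr h]
    ring
  · rw [if_neg h, if_neg fun h' => h h'.symm]
    simp

theorem avg_of_dependsOn {S : Finset (Fin d)} {p : (∀ k, Ω k) → ℝ} (hp : DependsOn p S)
    {y : ∀ k, Ω k} (hy : 0 < X.weight y) : X.avg S p y = p y := by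
  have h := X.avg_mul_of_dependsOn hp (fun _ => 1) y
  rw [← X.link_expect S y hy (fun _ => 1), expect_const] at h
  simpa using h

theorem expect_avg_mul_of_dependsOn {S : Finset (Fin d)} (f : (∀ k, Ω k) → ℝ)
    {p : (∀ k, Ω k) → ℝ} (hp : DependsOn p S) :
    (X.expect fun x => X.avg S f x * p x) = X.expect fun x => f x * p x := by
  rw [expect_avg_mul]
  exact X.expect_congr fun x hx => by rw [X.avg_of_dependsOn hp hx]

theorem expect_avg (S : Finset (Fin d)) (f : (∀ k, Ω k) → ℝ) :
    X.expect (X.avg S f) = X.expect f := by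
  simpa using X.expect_avg_mul_of_dependsOn (S := S) f (p := fun _ => 1) fun _ _ _ => rfl

/-- The tower property. -/
theorem avg_avg {S T : Finset (Fin d)} (hST : S ⊆ T) (f : (∀ k, Ω k) → ℝ)
    (y : ∀ k, Ω k) : X.avg S (X.avg T f) y = X.avg S f y := by
  classical
  -- test against the indicator of the face, which depends on the coordinates in `T`
  have h := X.expect_avg_mul_of_dependsOn (S := T) f (p := fun x => if Agree S x y then 1 else 0)
    (fun x z hxz => by
      have h : Agree S x z := Agree.mono hST hxz
      have h' : Agree S x y ↔ Agree S z y := ⟨fun a => h.symm.trans a, fun a => h.trans a⟩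
      simp only [h'])
  have e : ∀ f : (∀ k, Ω k) → ℝ, X.avg S f y =
      (X.expect fun x => f x * if Agree S x y then 1 else 0) / X.marginal S y := fun f => by
    unfold avg expect
    congr 1
    exact sum_congr rfl fun x _ => by by_cases hx : Agree S x y <;> simp [hx]
  rw [e, e, h]

theorem sq_avg_le (S : Finset (Fin d)) (f : (∀ k, Ω k) → ℝ) {y : ∀ k, Ω k}
    (hy : 0 < X.weight y) : X.avg S f y ^ 2 ≤ X.avg S (fun x => f x ^ 2) y := by
  rw [← X.link_expect S y hy, ← X.link_expect S y hy]
  have h := (X.link S y hy).abs_expect_mul_le f fun _ => 1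
  have e : (X.link S y hy).l2 (fun _ => 1) = 1 := by simp [l2, expect_const]
  simp only [mul_one, e] at h
  rw [← l2_sq, ← sq_abs]
  exact pow_le_pow_left₀ (abs_nonneg _) h 2

theorem l2_avg_le (S : Finset (Fin d)) (f : (∀ k, Ω k) → ℝ) : X.l2 (X.avg S f) ≤ X.l2 f := by
  refine Real.sqrt_le_sqrt ?_
  rw [← X.expect_avg S fun x => f x ^ 2]
  exact X.expect_mono fun x hx => X.sq_avg_le S f hx

/-- In the link of `y_S` the averaging operator of `T` is that of `S ∪ T`. -/
theorem link_avg {S T : Finset (Fin d)} {x y : ∀ k, Ω k} (hy : 0 < X.weight y)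
    (hxy : Agree S x y) (f : (∀ k, Ω k) → ℝ) :
    (X.link S y hy).avg T f x = X.avg (S ∪ T) f x := by
  classical
  have hU : ∀ z, Agree (S ∪ T) z x ↔ Agree T z x ∧ Agree S z y := fun z => by
    rw [← agree_congr hxy z]
    simp only [Agree, mem_union]
    exact ⟨fun h => ⟨fun k hk => h k (.inr hk), fun k hk => h k (.inl hk)⟩,
      fun h k hk => hk.elim (h.2 k) (h.1 k)⟩
  have e1 : (∑ z, if Agree T z x then (X.link S y hy).weight z * f z else 0) =
      (∑ z, if Agree (S ∪ T) z x then X.weight z * f z else 0) / X.marginal S y := by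
    rw [sum_div]
    refine sum_congr rfl fun z _ => ?_
    simp only [link, hU, ite_and]
    split_ifs <;> ring
  have e2 : (X.link S y hy).marginal T x = X.marginal (S ∪ T) x / X.marginal S y := by
    unfold marginal
    rw [sum_div]
    refine sum_congr rfl fun z _ => ?_
    simp only [link, hU, ite_and, marginal]
    split_ifs <;> simp
  have hm := (X.marginal_pos S hy).ne'
  unfold avg
  rw [e2, e1, div_div_div_cancel_right₀ hm]

/-! ### Conditional expectations nearly commute in a `γ`-product -/

variable {X}

/-- The defining bound of a `γ`-product, averaged over all links of one set of coordinates. -/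
theorem IsGammaProduct.expect_sq_avg_insert_sub_le {γ : ℝ} (hγ : 0 ≤ γ)
    (hX : X.IsGammaProduct γ) {R : Finset (Fin d)} {t u : Fin d} (ht : t ∉ R) (hu : u ∉ R)
    (htu : t ≠ u) {g : (∀ k, Ω k) → ℝ} (hg : DependsOn g (insert u R : Finset (Fin d))) :
    X.l2 (fun x => X.avg (insert t R) g x - X.avg R g x) ≤ γ * X.l2 g := by
  classical
  refine Real.sqrt_le_iff.2 ⟨mul_nonneg hγ (X.l2_nonneg g), ?_⟩
  rw [mul_pow, l2_sq, ← X.expect_avg R fun x => g x ^ 2, ← expect_const_mul,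
    ← X.expect_avg R fun x => (_ : ℝ) ^ 2]
  refine X.expect_mono fun y hy => ?_
  have hL := hX R y hy u t hu ht htu.symm fun a => g (Function.update y u a)
  -- inside the link of `y_R` the function `g` is a function of the coordinate `u` alone
  have hloc : ∀ x, Agree R x y → g (Function.update y u (x u)) = g x := fun x hx => by
    refine hg fun k hk => ?_
    rcases eq_or_ne k u with rfl | hku
    · simp
    · rw [Function.update_of_ne hku]
      exact (hx k ((mem_insert.1 hk).resolve_left hku)).symm
  rw [lpNorm_two, lpNorm_two] at hL
  have hL2 := pow_le_pow_left₀ (l2_nonneg _ _) hL 2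
  rw [mul_pow, l2_sq, l2_sq, link_expect, link_expect, link_expect] at hL2
  rw [X.avg_congr (f := fun x => g (Function.update y u (x u)) ^ 2) (g := fun x => g x ^ 2)
    fun x hx => by rw [hloc x hx]] at hL2
  refine le_trans (le_of_eq (X.avg_congr fun x hx => ?_)) hL2
  congr 1
  have e1 : (X.link R y hy).avg {t} (fun x => g (Function.update y u (x u))) x =
      X.avg (insert t R) g x := by
    rw [X.link_avg hy hx, union_comm, ← insert_eq]
    exact X.avg_congr fun z hz => hloc z ((Agree.mono (subset_insert t R) hz).trans hx)
  rw [e1, X.avg_congr (g := g) (f := fun x => g (Function.update y u (x u))) hloc,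
    X.avg_dependsOn R g hx]

/-- A coordinate `t ∈ T \ U` is removed from `T` in two steps: first `p` is averaged over the
coordinates in `T ∩ (U ∪ {t})`, then this average is compared with `r`. -/
theorem abs_expect_mul_sub_of_steps {T U : Finset (Fin d)} {t : Fin d} {c₁ c₂ : ℝ} (hc₂ : 0 ≤ c₂)
    (h₁ : ∀ p r : (∀ k, Ω k) → ℝ, DependsOn p T → DependsOn r (insert t U : Finset (Fin d)) →
      |(X.expect fun x => p x * r x) - X.expect fun x =>
        X.avg (T ∩ insert t U) p x * X.avg (T ∩ insert t U) r x| ≤ c₁ * (X.l2 p * X.l2 r))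
    (h₂ : ∀ p r : (∀ k, Ω k) → ℝ, DependsOn p (T ∩ insert t U : Finset (Fin d)) → DependsOn r U →
      |(X.expect fun x => p x * r x) - X.expect fun x =>
        X.avg (T ∩ U) p x * X.avg (T ∩ U) r x| ≤ c₂ * (X.l2 p * X.l2 r))
    (p r : (∀ k, Ω k) → ℝ) (hp : DependsOn p T) (hr : DependsOn r U) :
    |(X.expect fun x => p x * r x) - X.expect fun x =>
      X.avg (T ∩ U) p x * X.avg (T ∩ U) r x| ≤ (c₁ + c₂) * (X.l2 p * X.l2 r) := by
  have a₁ := h₁ p r hp (hr.mono (by simp))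
  have a₂ := h₂ (X.avg (T ∩ insert t U) p) r (X.avg_dependsOn _ _) hr
  rw [X.expect_avg_mul_of_dependsOn _ (X.avg_dependsOn _ _)] at a₁
  rw [X.expect_avg_mul] at a₂
  have e : (X.expect fun x => X.avg (T ∩ U) (X.avg (T ∩ insert t U) p) x * X.avg (T ∩ U) r x) =
      X.expect fun x => X.avg (T ∩ U) p x * X.avg (T ∩ U) r x :=
    X.expect_congr fun x _ => by
      rw [X.avg_avg (inter_subset_inter_left (subset_insert t U)) p x]
  rw [e] at a₂
  have hle : X.l2 (X.avg (T ∩ insert t U) p) * X.l2 r ≤ X.l2 p * X.l2 r :=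
    mul_le_mul_of_nonneg_right (X.l2_avg_le _ _) (X.l2_nonneg _)
  have a₂' := a₂.trans (mul_le_mul_of_nonneg_left hle hc₂)
  rw [add_mul]
  exact (abs_sub_le _ _ _).trans (add_le_add a₁ a₂')

/-- Juntas on `T` and on `U` are nearly independent given the coordinates in `T ∩ U`. The
coordinates of the symmetric difference are removed one by one. -/
theorem IsGammaProduct.abs_expect_mul_sub_le_card {γ : ℝ} (hγ : 0 ≤ γ) (hX : X.IsGammaProduct γ)
    (n : ℕ) : ∀ (T U : Finset (Fin d)), (T \ U).card + (U \ T).card = n →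
    ∀ p r : (∀ k, Ω k) → ℝ, DependsOn p T → DependsOn r U →
      |(X.expect fun x => p x * r x) - X.expect fun x =>
        X.avg (T ∩ U) p x * X.avg (T ∩ U) r x| ≤
          ((T \ U).card * (U \ T).card * γ) * (X.l2 p * X.l2 r) := by
  classical
  induction n using Nat.strong_induction_on with
  | _ n ih =>
  -- the step that removes a coordinate of `T \ U` other than the last one
  have step : ∀ (T U : Finset (Fin d)), (T \ U).card + (U \ T).card = n → 2 ≤ (T \ U).card →
      ∀ p r : (∀ k, Ω k) → ℝ, DependsOn p T → DependsOn r U →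
        |(X.expect fun x => p x * r x) - X.expect fun x =>
          X.avg (T ∩ U) p x * X.avg (T ∩ U) r x| ≤
            ((T \ U).card * (U \ T).card * γ) * (X.l2 p * X.l2 r) := by
    intro T U hn h2 p r hp hr
    obtain ⟨t, ht⟩ := card_pos.1 (by omega : 0 < (T \ U).card)
    obtain ⟨htT, htU⟩ := mem_sdiff.1 ht
    have c1 : (T \ insert t U).card + 1 = (T \ U).card := by
      rw [sdiff_insert, card_erase_of_mem ht]
      omega
    have c2 : insert t U \ T = U \ T := insert_sdiff_of_mem _ htT
    have c3 : (T ∩ insert t U) \ U = {t} := by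
      ext k
      simp only [mem_sdiff, mem_inter, mem_insert, mem_singleton]
      constructor
      · rintro ⟨⟨_, h | h⟩, h'⟩
        · exact h
        · exact absurd h h'
      · rintro rfl
        exact ⟨⟨htT, .inl rfl⟩, htU⟩
    have c4 : U \ (T ∩ insert t U) = U \ T := by
      ext k
      simp only [mem_sdiff, mem_inter, mem_insert]
      tauto
    have c5 : T ∩ insert t U ∩ U = T ∩ U := by
      ext k
      simp only [mem_inter, mem_insert]
      tauto
    have h₁ := ih _ (by rw [c2]; omega) T (insert t U) rfl
    have h₂ := ih _ (by rw [c3, c4, card_singleton]; omega) (T ∩ insert t U) U rfl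
    rw [c5] at h₂
    refine (abs_expect_mul_sub_of_steps (by positivity) h₁ h₂ p r hp hr).trans
      (le_of_eq ?_)
    rw [c2, c3, c4, card_singleton, ← c1]
    push_cast
    ring
  intro T U hn p r hp hr
  rcases le_or_gt 2 (T \ U).card with h2 | h2
  · exact step T U hn h2 p r hp hr
  rcases le_or_gt 2 (U \ T).card with h3 | h3
  · have h := step U T (by omega) h3 r p hr hp
    simp only [inter_comm U T, mul_comm (r _), mul_comm (X.avg _ r _)] at h
    rw [mul_comm (X.l2 r), mul_comm ((U \ T).card : ℝ)] at h
    exact h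
  rcases Nat.eq_zero_or_pos (T \ U).card with h0 | h0
  · have hTU : T ⊆ U := sdiff_eq_empty_iff_subset.1 (card_eq_zero.1 h0)
    rw [inter_eq_left.2 hTU, X.expect_avg_mul_of_dependsOn _ (X.avg_dependsOn _ _),
      ← X.expect_avg_mul, X.expect_congr (f := fun x => X.avg T p x * r x)
        (g := fun x => p x * r x) fun x hx => by rw [X.avg_of_dependsOn hp hx]]
    simp [h0]
  rcases Nat.eq_zero_or_pos (U \ T).card with h1 | h1
  · have hTU : U ⊆ T := sdiff_eq_empty_iff_subset.1 (card_eq_zero.1 h1)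
    rw [inter_eq_right.2 hTU, X.expect_avg_mul_of_dependsOn _ (X.avg_dependsOn _ _),
      X.expect_congr (f := fun x => p x * X.avg U r x)
        (g := fun x => p x * r x) fun x hx => by rw [X.avg_of_dependsOn hr hx]]
    simp [h1]
  have hT1 : (T \ U).card = 1 := by omega
  have hU1 : (U \ T).card = 1 := by omega
  obtain ⟨t, ht⟩ := card_eq_one.1 hT1
  obtain ⟨u, hu⟩ := card_eq_one.1 hU1
  have htm : t ∈ T \ U := by simp [ht]
  have hum : u ∈ U \ T := by simp [hu]
  rw [mem_sdiff] at htm hum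
  have eT : insert t (T ∩ U) = T := by
    rw [insert_eq, ← ht, sdiff_union_inter]
  have eU : insert u (T ∩ U) = U := by
    rw [insert_eq, ← hu, inter_comm, sdiff_union_inter]
  have hb := hX.expect_sq_avg_insert_sub_le hγ (R := T ∩ U) (t := t) (u := u) (g := r)
    (by simp [htm]) (by simp [hum]) (fun h => hum.2 (h ▸ htm.1)) (by rwa [eU])
  rw [eT] at hb
  rw [X.expect_avg_mul_of_dependsOn _ (X.avg_dependsOn _ _),
    ← X.expect_congr (f := fun x => X.avg T p x * r x)
      (g := fun x => p x * r x) fun x hx => by rw [X.avg_of_dependsOn hp hx],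
    X.expect_avg_mul, ← expect_sub, hT1, hU1]
  simp only [← mul_sub]
  refine (X.abs_expect_mul_le _ _).trans ((mul_le_mul_of_nonneg_left hb (X.l2_nonneg p)).trans
    (le_of_eq ?_))
  push_cast
  ring

theorem natCast_le_two_pow (n : ℕ) : (n : ℝ) ≤ 2 ^ n := by
  exact_mod_cast Nat.lt_two_pow_self.le

theorem IsGammaProduct.abs_expect_mul_sub_le {γ : ℝ} (hγ : 0 ≤ γ) (hX : X.IsGammaProduct γ)
    {T U : Finset (Fin d)} {p r : (∀ k, Ω k) → ℝ} (hp : DependsOn p T) (hr : DependsOn r U) :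
    |(X.expect fun x => p x * r x) - X.expect fun x =>
      X.avg (T ∩ U) p x * X.avg (T ∩ U) r x| ≤ 4 ^ d * γ * (X.l2 p * X.l2 r) := by
  refine (hX.abs_expect_mul_sub_le_card hγ _ T U rfl p r hp hr).trans ?_
  refine mul_le_mul_of_nonneg_right (mul_le_mul_of_nonneg_right ?_ hγ)
    (mul_nonneg (X.l2_nonneg p) (X.l2_nonneg r))
  have h : ∀ S : Finset (Fin d), (S.card : ℝ) ≤ 2 ^ d := fun S =>
    (Nat.cast_le.2 (by simpa using S.card_le_univ : S.card ≤ d)).trans (natCast_le_two_pow d)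
  calc ((T \ U).card * (U \ T).card : ℝ) ≤ 2 ^ d * 2 ^ d :=
        mul_le_mul (h _) (h _) (Nat.cast_nonneg _) (by positivity)
    _ = 4 ^ d := by rw [← mul_pow]; norm_num

variable (X)

/-! ### Relative Efron–Stein components -/

/-- The Efron–Stein component of `f` on the set `W` relative to `R`: for disjoint `R` and `W`, its
restriction to the link of a face `y_R` is the component `(f|_{y_R})^{=W}` of the restriction. -/
noncomputable def comp (R W : Finset (Fin d)) (f : (∀ k, Ω k) → ℝ) (x : ∀ k, Ω k) : ℝ :=
  ∑ U ∈ W.powerset, (-1) ^ (W \ U).card * X.avg (R ∪ U) f x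

theorem comp_empty (S : Finset (Fin d)) (f : (∀ k, Ω k) → ℝ) :
    X.comp ∅ S f = X.efronStein f S := by
  funext x
  simp only [comp, efronStein, empty_union]

theorem comp_dependsOn (R W : Finset (Fin d)) (f : (∀ k, Ω k) → ℝ) :
    DependsOn (X.comp R W f) (R ∪ W : Finset (Fin d)) := by
  intro x y h
  refine sum_congr rfl fun U hU => ?_
  rw [(X.avg_dependsOn (R ∪ U) f).mono
    (coe_subset.2 (union_subset_union_right (mem_powerset.1 hU))) h]

/-- Multiplication by a function of the coordinates in `R` commutes with the components relative
to `R`. -/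
theorem comp_mul_of_dependsOn {R W : Finset (Fin d)} {p : (∀ k, Ω k) → ℝ} (hp : DependsOn p R)
    (f : (∀ k, Ω k) → ℝ) (y : ∀ k, Ω k) :
    X.comp R W (fun x => p x * f x) y = p y * X.comp R W f y := by
  unfold comp
  rw [mul_sum]
  refine sum_congr rfl fun U _ => ?_
  rw [X.avg_mul_of_dependsOn (hp.mono (coe_subset.2 subset_union_left))]
  ring

theorem two_pow_card_le (W : Finset (Fin d)) : (2 : ℝ) ^ W.card ≤ 2 ^ d :=
  pow_le_pow_right₀ one_le_two (by simpa using W.card_le_univ)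

theorem abs_comp_le {f : (∀ k, Ω k) → ℝ} {i : ℕ} {M : ℝ} (hM0 : 0 ≤ M)
    (hM : ∀ S : Finset (Fin d), S.card ≤ i → ∀ y, 0 < X.weight y →
      X.avg S (fun x => f x ^ 2) y ≤ M ^ 2)
    {R W : Finset (Fin d)} (hRW : (R ∪ W).card ≤ i) {y : ∀ k, Ω k} (hy : 0 < X.weight y) :
    |X.comp R W f y| ≤ 2 ^ d * M := by
  calc |X.comp R W f y| ≤ ∑ U ∈ W.powerset, M := by
        refine (abs_sum_le_sum_abs _ _).trans (sum_le_sum fun U hU => ?_)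
        rw [abs_mul, abs_pow, abs_neg, abs_one, one_pow, one_mul]
        refine abs_le_of_sq_le_sq ((X.sq_avg_le _ f hy).trans (hM _ (le_trans (card_le_card ?_) hRW)
          y hy)) hM0
        exact union_subset_union_right (mem_powerset.1 hU)
    _ = 2 ^ W.card * M := by simp
    _ ≤ 2 ^ d * M := mul_le_mul_of_nonneg_right (two_pow_card_le W) hM0

theorem l2_comp_le (R W : Finset (Fin d)) (f : (∀ k, Ω k) → ℝ) :
    X.l2 (X.comp R W f) ≤ 2 ^ d * X.l2 f := by
  refine (Real.sqrt_le_iff.2 ⟨mul_nonneg (by positivity) (X.l2_nonneg f), ?_⟩)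
  calc (X.expect fun x => X.comp R W f x ^ 2)
      ≤ X.expect fun x => 2 ^ W.card * ∑ U ∈ W.powerset, X.avg (R ∪ U) f x ^ 2 := by
        refine X.expect_mono fun x _ => sq_sum_le_card_mul_sum_sq.trans (le_of_eq ?_)
        rw [card_powerset]
        push_cast
        congr 1
        refine sum_congr rfl fun U _ => ?_
        rw [mul_pow, ← pow_mul, mul_comm _ 2, pow_mul]
        simp
    _ = 2 ^ W.card * ∑ U ∈ W.powerset, X.l2 (X.avg (R ∪ U) f) ^ 2 := by
        rw [expect_const_mul, expect_sum]
        simp only [l2_sq]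
    _ ≤ 2 ^ W.card * ∑ U ∈ W.powerset, X.l2 f ^ 2 := by
        gcongr
        · exact X.l2_nonneg _
        · exact X.l2_avg_le _ _
    _ = (2 ^ W.card * X.l2 f) ^ 2 := by
        rw [sum_const, card_powerset, nsmul_eq_mul]
        push_cast
        ring
    _ ≤ (2 ^ d * X.l2 f) ^ 2 := by
        have := two_pow_card_le W
        have := X.l2_nonneg f
        gcongr

variable {X} {γ : ℝ}

/-- The component on `W` is nearly orthogonal to every junta whose coordinates miss a point of
`W`: in the alternating sum that defines it, adding or removing that point changes nothing up to
the error of `IsGammaProduct.abs_expect_mul_sub_le`. -/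
theorem IsGammaProduct.abs_expect_comp_mul_le (hγ : 0 ≤ γ) (hX : X.IsGammaProduct γ)
    {R W V : Finset (Fin d)} (hWV : ¬W ⊆ V) (f : (∀ k, Ω k) → ℝ) {p : (∀ k, Ω k) → ℝ}
    (hp : DependsOn p V) :
    |X.expect fun x => X.comp R W f x * p x| ≤ 8 ^ d * γ * (X.l2 f * X.l2 p) := by
  classical
  obtain ⟨e, heW, heV⟩ := not_subset.1 hWV
  set ψ : Finset (Fin d) → ℝ := fun U =>
    X.expect fun x => X.avg ((R ∪ U) ∩ V) f x * X.avg ((R ∪ U) ∩ V) p x with hψ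
  have hzero : ∑ U ∈ W.powerset, (-1 : ℝ) ^ (W \ U).card * ψ U = 0 := by
    rw [← insert_erase heW, sum_powerset_insert (notMem_erase e W), ← sum_add_distrib]
    refine sum_eq_zero fun U hU => ?_
    have heU : e ∉ U := fun h => notMem_erase e W (mem_powerset.1 hU h)
    have h1 : ψ (insert e U) = ψ U := by
      simp only [hψ, union_insert, insert_inter_of_notMem heV]
    have h2 : insert e (W.erase e) \ insert e U = W.erase e \ U := by
      rw [insert_sdiff_insert, sdiff_insert_of_notMem (notMem_erase e W)]
    have h3 : (insert e (W.erase e) \ U).card = (W.erase e \ U).card + 1 := by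
      rw [insert_sdiff_of_notMem _ heU, card_insert_of_notMem (by simp)]
    rw [h1, h2, h3, pow_succ]
    ring
  have hexp : (X.expect fun x => X.comp R W f x * p x) =
      ∑ U ∈ W.powerset, (-1 : ℝ) ^ (W \ U).card *
        ((X.expect fun x => X.avg (R ∪ U) f x * p x) - ψ U) := by
    simp only [mul_sub, sum_sub_distrib, hzero, sub_zero, ← expect_const_mul, ← expect_sum]
    congr 1
    funext x
    rw [comp, sum_mul]
    exact sum_congr rfl fun U _ => by ring
  rw [hexp]
  have hN : 0 ≤ 4 ^ d * γ * (X.l2 f * X.l2 p) :=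
    mul_nonneg (by positivity) (mul_nonneg (X.l2_nonneg f) (X.l2_nonneg p))
  calc _ ≤ ∑ U ∈ W.powerset, 4 ^ d * γ * (X.l2 f * X.l2 p) := by
        refine (abs_sum_le_sum_abs _ _).trans (sum_le_sum fun U _ => ?_)
        rw [abs_mul, abs_pow, abs_neg, abs_one, one_pow, one_mul]
        have h := hX.abs_expect_mul_sub_le hγ (X.avg_dependsOn (R ∪ U) f) hp
        have e1 : (X.expect fun x => X.avg ((R ∪ U) ∩ V) (X.avg (R ∪ U) f) x *
            X.avg ((R ∪ U) ∩ V) p x) = ψ U :=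
          X.expect_congr fun x _ => by rw [X.avg_avg inter_subset_left]
        rw [e1] at h
        refine h.trans (mul_le_mul_of_nonneg_left ?_ (by positivity))
        exact mul_le_mul_of_nonneg_right (X.l2_avg_le _ _) (X.l2_nonneg p)
    _ = 2 ^ W.card * (4 ^ d * γ * (X.l2 f * X.l2 p)) := by simp
    _ ≤ 2 ^ d * (4 ^ d * γ * (X.l2 f * X.l2 p)) :=
        mul_le_mul_of_nonneg_right (two_pow_card_le W) hN
    _ = 8 ^ d * γ * (X.l2 f * X.l2 p) := by
        rw [show (8 : ℝ) = 2 * 4 by norm_num, mul_pow]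
        ring

theorem IsGammaProduct.abs_expect_comp_mul_comp_le (hγ : 0 ≤ γ) (hX : X.IsGammaProduct γ)
    {R W W' : Finset (Fin d)} (hW : Disjoint W R) (hW' : Disjoint W' R) (hne : W ≠ W')
    (f : (∀ k, Ω k) → ℝ) :
    |X.expect fun x => X.comp R W f x * X.comp R W' f x| ≤ 16 ^ d * γ * X.l2 f ^ 2 := by
  have key : ∀ W W' : Finset (Fin d), Disjoint W R → ¬W ⊆ W' →
      |X.expect fun x => X.comp R W f x * X.comp R W' f x| ≤ 16 ^ d * γ * X.l2 f ^ 2 := by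
    intro W W' hW h
    refine (hX.abs_expect_comp_mul_le hγ (V := R ∪ W') (fun h' => h ?_) f
      (X.comp_dependsOn R W' f)).trans ?_
    · exact hW.left_le_of_le_sup_left h'
    · calc 8 ^ d * γ * (X.l2 f * X.l2 (X.comp R W' f))
          ≤ 8 ^ d * γ * (X.l2 f * (2 ^ d * X.l2 f)) := by
            have := X.l2_comp_le R W' f
            have := X.l2_nonneg f
            gcongr
        _ = 16 ^ d * γ * X.l2 f ^ 2 := by
            rw [show (16 : ℝ) = 8 * 2 by norm_num, mul_pow]
            ring
  by_cases h : W ⊆ W'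
  · have h' : ¬W' ⊆ W := fun h' => hne (h.antisymm h')
    simpa only [mul_comm] using key W' W hW' h'
  · exact key W W' hW h

theorem card_finset_le (𝒲 : Finset (Finset (Fin d))) : (𝒲.card : ℝ) ≤ 2 ^ d := by
  have h : 𝒲.card ≤ 2 ^ d := by simpa using 𝒲.card_le_univ
  exact_mod_cast h

/-- Approximate Parseval identity. -/
theorem IsGammaProduct.abs_expect_sq_sum_comp_sub_le (hγ : 0 ≤ γ) (hX : X.IsGammaProduct γ)
    {R : Finset (Fin d)} {𝒲 : Finset (Finset (Fin d))} (h𝒲 : ∀ W ∈ 𝒲, Disjoint W R)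
    (f : (∀ k, Ω k) → ℝ) :
    |(X.expect fun x => (∑ W ∈ 𝒲, X.comp R W f x) ^ 2) -
      ∑ W ∈ 𝒲, X.expect fun x => X.comp R W f x ^ 2| ≤ 64 ^ d * γ * X.l2 f ^ 2 := by
  classical
  have hB : 0 ≤ 16 ^ d * γ * X.l2 f ^ 2 := by positivity
  have e : (X.expect fun x => (∑ W ∈ 𝒲, X.comp R W f x) ^ 2) -
      ∑ W ∈ 𝒲, X.expect (fun x => X.comp R W f x ^ 2) =
      ∑ W ∈ 𝒲, ∑ W' ∈ 𝒲, if W = W' then 0 else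
        X.expect fun x => X.comp R W f x * X.comp R W' f x := by
    simp only [sq, sum_mul_sum, expect_sum]
    rw [← sum_sub_distrib]
    refine sum_congr rfl fun W hW => ?_
    rw [← add_sum_erase _ _ hW, ← add_sum_erase _ _ hW, if_pos rfl, zero_add, add_sub_cancel_left]
    exact sum_congr rfl fun W' hW' => by rw [if_neg (ne_of_mem_erase hW').symm]
  rw [e]
  calc _ ≤ ∑ W ∈ 𝒲, ∑ W' ∈ 𝒲, 16 ^ d * γ * X.l2 f ^ 2 := by
        refine (abs_sum_le_sum_abs _ _).trans (sum_le_sum fun W hW => ?_)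
        refine (abs_sum_le_sum_abs _ _).trans (sum_le_sum fun W' hW' => ?_)
        split_ifs with h
        · simpa using hB
        · exact hX.abs_expect_comp_mul_comp_le hγ (h𝒲 W hW) (h𝒲 W' hW') h f
    _ = 𝒲.card * (𝒲.card * (16 ^ d * γ * X.l2 f ^ 2)) := by simp
    _ ≤ 2 ^ d * (2 ^ d * (16 ^ d * γ * X.l2 f ^ 2)) := by
        have := card_finset_le 𝒲
        gcongr
    _ = 64 ^ d * γ * X.l2 f ^ 2 := by
        rw [show (64 : ℝ) = 2 * 2 * 16 by norm_num, mul_pow, mul_pow]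
        ring

/-- A component behaves like an orthogonal projection of `f`: its squared norm is nearly its inner
product with `f`. This replaces the inversion formula for `f` in the proof of Bessel's inequality. -/
theorem IsGammaProduct.abs_expect_comp_sq_sub_le (hγ : 0 ≤ γ) (hX : X.IsGammaProduct γ)
    {R W : Finset (Fin d)} (hW : Disjoint W R) (f : (∀ k, Ω k) → ℝ) :
    |(X.expect fun x => X.comp R W f x ^ 2) - X.expect fun x => X.comp R W f x * f x| ≤
      32 ^ d * γ * X.l2 f ^ 2 := by
  classical
  have hB : 0 ≤ 16 ^ d * γ * X.l2 f ^ 2 := by positivity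
  have e : (X.expect fun x => X.comp R W f x ^ 2) - (X.expect fun x => X.comp R W f x * f x) =
      ∑ U ∈ W.powerset.erase W, (-1 : ℝ) ^ (W \ U).card *
        X.expect fun x => X.comp R W f x * X.avg (R ∪ U) f x := by
    have e1 : (X.expect fun x => X.comp R W f x ^ 2) =
        ∑ U ∈ W.powerset, (-1 : ℝ) ^ (W \ U).card *
          X.expect fun x => X.comp R W f x * X.avg (R ∪ U) f x := by
      simp only [← expect_const_mul, ← expect_sum]
      congr 1
      funext x
      rw [sq]
      nth_rw 2 [comp]
      rw [mul_sum]
      exact sum_congr rfl fun U _ => by ring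
    rw [e1, ← add_sum_erase _ _ (mem_powerset_self W)]
    have e2 : (X.expect fun x => X.comp R W f x * X.avg (R ∪ W) f x) =
        X.expect fun x => X.comp R W f x * f x := by
      simp only [mul_comm (X.comp R W f _)]
      exact X.expect_avg_mul_of_dependsOn f (X.comp_dependsOn R W f)
    rw [e2, sdiff_self]
    simp
  rw [e]
  calc _ ≤ ∑ U ∈ W.powerset.erase W, 16 ^ d * γ * X.l2 f ^ 2 := by
        refine (abs_sum_le_sum_abs _ _).trans (sum_le_sum fun U hU => ?_)
        rw [abs_mul, abs_pow, abs_neg, abs_one, one_pow, one_mul]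
        have hUW : U ⊆ W := mem_powerset.1 (mem_of_mem_erase hU)
        have hne : ¬W ⊆ R ∪ U := fun h =>
          ne_of_mem_erase hU (hUW.antisymm (hW.left_le_of_le_sup_left h))
        refine (hX.abs_expect_comp_mul_le hγ hne f (X.avg_dependsOn (R ∪ U) f)).trans ?_
        calc 8 ^ d * γ * (X.l2 f * X.l2 (X.avg (R ∪ U) f))
            ≤ 16 ^ d * γ * (X.l2 f * X.l2 f) := by
              have := X.l2_avg_le (R ∪ U) f
              have := X.l2_nonneg f
              have := X.l2_nonneg (X.avg (R ∪ U) f)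
              gcongr
              norm_num
          _ = 16 ^ d * γ * X.l2 f ^ 2 := by ring
    _ = (W.powerset.erase W).card * (16 ^ d * γ * X.l2 f ^ 2) := by simp
    _ ≤ 2 ^ d * (16 ^ d * γ * X.l2 f ^ 2) := by
        have := card_finset_le (W.powerset.erase W)
        gcongr
    _ = 32 ^ d * γ * X.l2 f ^ 2 := by
        rw [show (32 : ℝ) = 2 * 16 by norm_num, mul_pow]
        ring

/-- Approximate Bessel inequality. -/
theorem IsGammaProduct.sum_expect_comp_sq_le (hγ : 0 ≤ γ) (hX : X.IsGammaProduct γ)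
    (hγd : 3 * 64 ^ d * γ ≤ 1) {R : Finset (Fin d)} {𝒲 : Finset (Finset (Fin d))}
    (h𝒲 : ∀ W ∈ 𝒲, Disjoint W R) (f : (∀ k, Ω k) → ℝ) :
    ∑ W ∈ 𝒲, (X.expect fun x => X.comp R W f x ^ 2) ≤ 2 * X.l2 f ^ 2 := by
  have h0 : 0 ≤ X.expect fun x => (f x - ∑ W ∈ 𝒲, X.comp R W f x) ^ 2 :=
    X.expect_nonneg fun _ _ => sq_nonneg _
  have e : (X.expect fun x => (f x - ∑ W ∈ 𝒲, X.comp R W f x) ^ 2) =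
      X.l2 f ^ 2 - 2 * (∑ W ∈ 𝒲, X.expect fun x => X.comp R W f x * f x) +
        X.expect fun x => (∑ W ∈ 𝒲, X.comp R W f x) ^ 2 := by
    rw [l2_sq, ← expect_sum, ← expect_const_mul, ← expect_sub, ← expect_add]
    congr 1
    funext x
    rw [← sum_mul]
    ring
  have h1 := (abs_le.1 (hX.abs_expect_sq_sum_comp_sub_le hγ h𝒲 f)).2
  have h2 : ∑ W ∈ 𝒲, (X.expect fun x => X.comp R W f x ^ 2) -
      ∑ W ∈ 𝒲, (X.expect fun x => X.comp R W f x * f x) ≤ 64 ^ d * γ * X.l2 f ^ 2 := by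
    rw [← sum_sub_distrib]
    calc _ ≤ ∑ W ∈ 𝒲, 32 ^ d * γ * X.l2 f ^ 2 :=
          sum_le_sum fun W hW => (abs_le.1 (hX.abs_expect_comp_sq_sub_le hγ (h𝒲 W hW) f)).2
      _ = 𝒲.card * (32 ^ d * γ * X.l2 f ^ 2) := by simp
      _ ≤ 2 ^ d * (32 ^ d * γ * X.l2 f ^ 2) := by
          have := card_finset_le 𝒲
          gcongr
      _ = 64 ^ d * γ * X.l2 f ^ 2 := by
          rw [show (64 : ℝ) = 2 * 32 by norm_num, mul_pow]
          ring
  have h3 : 3 * 64 ^ d * γ * X.l2 f ^ 2 ≤ 1 * X.l2 f ^ 2 :=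
    mul_le_mul_of_nonneg_right hγd (sq_nonneg _)
  linarith

variable (X)

/-! ### Moments of the sum of squared components -/

/-- For `r ≤ i` one has `4 ^ r ≤ (4 k) ^ i * (1 / k) ^ r`, which makes the sum binomial; then
`(1 + 1 / k) ^ k ≤ e` is used. -/
theorem sum_powerset_four_pow_card_le {ι : Type*} [DecidableEq ι] {i k : ℕ} (hk : 0 < k)
    {T : Finset ι} (hT : T.card ≤ i * k) :
    ∑ R ∈ T.powerset with R.card ≤ i, (4 : ℝ) ^ R.card ≤ (12 * k) ^ i := by
  have hk' : (0 : ℝ) < k := Nat.cast_pos.2 hk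
  have hk1 : (1 : ℝ) ≤ k := Nat.one_le_cast.2 hk
  calc ∑ R ∈ T.powerset with R.card ≤ i, (4 : ℝ) ^ R.card
      ≤ ∑ R ∈ T.powerset with R.card ≤ i, (4 * k : ℝ) ^ i * (1 / k : ℝ) ^ R.card := by
        refine sum_le_sum fun R hR => ?_
        calc (4 : ℝ) ^ R.card = (4 * k : ℝ) ^ R.card * (1 / k : ℝ) ^ R.card := by
              rw [← mul_pow]
              congr 1
              field_simp
          _ ≤ _ := by
              refine mul_le_mul_of_nonneg_right (pow_le_pow_right₀ (by linarith)
                (mem_filter.1 hR).2) (by positivity)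
    _ ≤ ∑ R ∈ T.powerset, (4 * k : ℝ) ^ i * (1 / k : ℝ) ^ R.card :=
        sum_le_sum_of_subset_of_nonneg (filter_subset _ _) fun _ _ _ => by positivity
    _ = (4 * k : ℝ) ^ i * (1 / k + 1 : ℝ) ^ T.card := by
        rw [← mul_sum, ← Finset.sum_pow_mul_eq_add_pow]
        simp
    _ ≤ (4 * k : ℝ) ^ i * (1 / k + 1 : ℝ) ^ (k * i) := by
        refine mul_le_mul_of_nonneg_left (pow_le_pow_right₀ ?_ (by rwa [mul_comm])) (by positivity)
        have : (0 : ℝ) < 1 / k := by positivity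
        linarith
    _ ≤ (4 * k : ℝ) ^ i * 3 ^ i := by
        rw [pow_mul]
        gcongr
        calc (1 / k + 1 : ℝ) ^ k ≤ Real.exp (1 / k) ^ k := by
              gcongr
              exact Real.add_one_le_exp _
          _ = Real.exp 1 := by
              rw [← Real.exp_nat_mul]
              congr 1
              field_simp
          _ ≤ 3 := Real.exp_one_lt_three.le
    _ = (12 * k : ℝ) ^ i := by
        rw [← mul_pow]
        congr 1
        ring

/-- Restricting the coordinates in `R` splits an Efron–Stein component into components relative to
the subsets of `R`. -/
theorem comp_empty_union {R W : Finset (Fin d)} (hRW : Disjoint R W) (f : (∀ k, Ω k) → ℝ)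
    (x : ∀ k, Ω k) :
    X.comp ∅ (R ∪ W) f x = ∑ R' ∈ R.powerset, (-1) ^ (R \ R').card * X.comp R' W f x := by
  classical
  simp only [comp, mul_sum, empty_union]
  rw [← sum_product']
  symm
  refine sum_nbij' (fun p => p.1 ∪ p.2) (fun V => (V ∩ R, V ∩ W)) ?_ ?_ ?_ ?_ ?_
  · rintro ⟨A, B⟩ h
    simp only [mem_product, mem_powerset] at h ⊢
    exact union_subset_union h.1 h.2
  · intro V _
    simp only [mem_product, mem_powerset]
    exact ⟨inter_subset_right, inter_subset_right⟩
  · rintro ⟨A, B⟩ h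
    simp only [mem_product, mem_powerset] at h
    have h1 : B ∩ R = ∅ := disjoint_iff_inter_eq_empty.1 (hRW.symm.mono_left h.2)
    have h2 : A ∩ W = ∅ := disjoint_iff_inter_eq_empty.1 (hRW.mono_left h.1)
    simp only [union_inter_distrib_right, h1, h2, union_empty, empty_union,
      inter_eq_left.2 h.1, inter_eq_left.2 h.2]
  · intro V hV
    simp only [mem_powerset] at hV
    simp only [← inter_union_distrib_left, inter_eq_left.2 hV]
  · rintro ⟨A, B⟩ h
    simp only [mem_product, mem_powerset] at h
    have e : (R ∪ W) \ (A ∪ B) = R \ A ∪ W \ B := by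
      ext k
      have h1 : k ∈ R → k ∉ W := fun a b => disjoint_left.1 hRW a b
      have h2 := @h.1 k
      have h3 := @h.2 k
      simp only [mem_sdiff, mem_union]
      tauto
    rw [e, card_union_of_disjoint (hRW.mono sdiff_subset sdiff_subset), pow_add]
    ring

theorem comp_empty_sq_le (S T : Finset (Fin d)) (f : (∀ k, Ω k) → ℝ) (x : ∀ k, Ω k) :
    X.comp ∅ S f x ^ 2 ≤
      2 ^ (S ∩ T).card * ∑ R' ∈ (S ∩ T).powerset, X.comp R' (S \ T) f x ^ 2 := by
  have e : S = S ∩ T ∪ S \ T := by rw [union_comm, sdiff_union_inter]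
  nth_rw 1 [e]
  rw [X.comp_empty_union (disjoint_sdiff_inter S T).symm]
  refine sq_sum_le_card_mul_sum_sq.trans (le_of_eq ?_)
  rw [card_powerset]
  push_cast
  congr 1
  refine sum_congr rfl fun U _ => ?_
  rw [mul_pow, ← pow_mul, mul_comm _ 2, pow_mul]
  simp

/-- The sum of the squares of the Efron–Stein components of degree at most `i`. -/
noncomputable def energy (f : (∀ k, Ω k) → ℝ) (i : ℕ) (x : ∀ k, Ω k) : ℝ :=
  ∑ S with S.card ≤ i, X.comp ∅ S f x ^ 2

variable {X}

/-- Given the coordinates in `T`, the components relative to `R ⊆ T` still satisfy Bessel's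
inequality up to a small error: first the weight `P` is replaced by its average over the
coordinates in `R`, then the square root of this average is moved into the function. -/
theorem IsGammaProduct.sum_expect_mul_comp_sq_le (hγ : 0 ≤ γ) (hX : X.IsGammaProduct γ)
    (hγd : 3 * 64 ^ d * γ ≤ 1) {f : (∀ k, Ω k) → ℝ} {i : ℕ} {M : ℝ} (hM0 : 0 ≤ M)
    (hM : ∀ S : Finset (Fin d), S.card ≤ i → ∀ y, 0 < X.weight y →
      X.avg S (fun x => f x ^ 2) y ≤ M ^ 2)
    {T R : Finset (Fin d)} (hRT : R ⊆ T) (hR : R.card ≤ i) {𝒲 : Finset (Finset (Fin d))}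
    (h𝒲 : ∀ W ∈ 𝒲, Disjoint W T ∧ (R ∪ W).card ≤ i)
    {P : (∀ k, Ω k) → ℝ} (hP0 : ∀ x, 0 ≤ P x) (hP : DependsOn P T) :
    ∑ W ∈ 𝒲, (X.expect fun x => P x * X.comp R W f x ^ 2) ≤
      2 * M ^ 2 * X.expect P + 32 ^ d * γ * M * X.l2 f * X.l2 P := by
  classical
  set Q := X.avg R P with hQ
  have hQ0 : ∀ x, 0 ≤ Q x := X.avg_nonneg hP0
  have hQd : DependsOn (fun x => √(Q x)) R := fun x y h => by
    simp only [hQ, X.avg_dependsOn R P h]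
  have hPn := X.l2_nonneg P
  have hfn := X.l2_nonneg f
  have hstep : ∀ W ∈ 𝒲, (X.expect fun x => P x * X.comp R W f x ^ 2) ≤
      (X.expect fun x => X.comp R W (fun x => √(Q x) * f x) x ^ 2) +
        16 ^ d * γ * M * X.l2 f * X.l2 P := by
    intro W hW
    obtain ⟨hWT, hRW⟩ := h𝒲 W hW
    have hHd : DependsOn (fun x => X.comp R W f x ^ 2) (R ∪ W : Finset (Fin d)) := fun x y h => by
      simp only [X.comp_dependsOn R W f h]
    have h := (abs_le.1 (hX.abs_expect_mul_sub_le hγ hP hHd)).2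
    have hTR : T ∩ (R ∪ W) = R := by
      rw [inter_union_distrib_left, inter_eq_right.2 hRT,
        disjoint_iff_inter_eq_empty.1 hWT.symm, union_empty]
    rw [hTR] at h
    have e1 : (X.expect fun x => X.avg R P x * X.avg R (fun x => X.comp R W f x ^ 2) x) =
        X.expect fun x => X.comp R W (fun x => √(Q x) * f x) x ^ 2 := by
      simp only [mul_comm (X.avg R P _)]
      rw [X.expect_avg_mul_of_dependsOn _ (X.avg_dependsOn _ _)]
      refine X.expect_congr fun x _ => ?_
      rw [X.comp_mul_of_dependsOn hQd, mul_pow, Real.sq_sqrt (hQ0 x), mul_comm]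
    have hl : X.l2 (fun x => X.comp R W f x ^ 2) ≤ 2 ^ d * M * (2 ^ d * X.l2 f) := by
      refine (X.l2_le_mul (g := X.comp R W f) (c := 2 ^ d * M) (by positivity)
        fun x hx => ?_).trans ?_
      · rw [abs_pow, sq]
        exact mul_le_mul_of_nonneg_right (X.abs_comp_le hM0 hM hRW hx) (abs_nonneg _)
      · exact mul_le_mul_of_nonneg_left (X.l2_comp_le R W f) (by positivity)
    rw [e1] at h
    have hb : 4 ^ d * γ * (X.l2 P * X.l2 fun x => X.comp R W f x ^ 2) ≤
        16 ^ d * γ * M * X.l2 f * X.l2 P := by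
      calc 4 ^ d * γ * (X.l2 P * X.l2 fun x => X.comp R W f x ^ 2)
          ≤ 4 ^ d * γ * (X.l2 P * (2 ^ d * M * (2 ^ d * X.l2 f))) := by gcongr
        _ = 16 ^ d * γ * M * X.l2 f * X.l2 P := by
            rw [show (16 : ℝ) = 4 * 2 * 2 by norm_num, mul_pow, mul_pow]
            ring
    linarith
  have hbessel := hX.sum_expect_comp_sq_le hγ hγd
    (fun W hW => (h𝒲 W hW).1.mono_right hRT) (fun x => √(Q x) * f x)
  have hQf : X.l2 (fun x => √(Q x) * f x) ^ 2 ≤ M ^ 2 * X.expect P := by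
    rw [l2_sq, ← X.expect_avg R P, ← expect_const_mul]
    calc (X.expect fun x => (√(Q x) * f x) ^ 2)
        = X.expect fun x => X.avg R (fun x => f x ^ 2) x * Q x := by
          rw [X.expect_avg_mul_of_dependsOn _ (X.avg_dependsOn _ _)]
          refine X.expect_congr fun x _ => ?_
          rw [mul_pow, Real.sq_sqrt (hQ0 x), mul_comm]
      _ ≤ X.expect fun x => M ^ 2 * Q x :=
          X.expect_mono fun x hx => mul_le_mul_of_nonneg_right (hM R hR x hx) (hQ0 x)
  calc ∑ W ∈ 𝒲, (X.expect fun x => P x * X.comp R W f x ^ 2)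
      ≤ ∑ W ∈ 𝒲, ((X.expect fun x => X.comp R W (fun x => √(Q x) * f x) x ^ 2) +
        16 ^ d * γ * M * X.l2 f * X.l2 P) := sum_le_sum hstep
    _ = ∑ W ∈ 𝒲, (X.expect fun x => X.comp R W (fun x => √(Q x) * f x) x ^ 2) +
        𝒲.card * (16 ^ d * γ * M * X.l2 f * X.l2 P) := by
        rw [sum_add_distrib]
        simp
    _ ≤ 2 * (M ^ 2 * X.expect P) + 2 ^ d * (16 ^ d * γ * M * X.l2 f * X.l2 P) := by
        have := card_finset_le 𝒲
        gcongr
        exact hbessel.trans (mul_le_mul_of_nonneg_left hQf zero_le_two)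
    _ = _ := by
        rw [show (32 : ℝ) = 2 * 16 by norm_num, mul_pow]
        ring

/-- Given a junta on at most `i * k` coordinates, the energy is on average at most
`2 (12 k)^i M²`. The components are grouped by the set `R` of their coordinates in `T`; the factor
`4^|R|` counts the subsets of `R` and the loss of Cauchy–Schwarz. -/
theorem IsGammaProduct.expect_mul_energy_le (hγ : 0 ≤ γ) (hX : X.IsGammaProduct γ)
    (hγd : 3 * 64 ^ d * γ ≤ 1) {f : (∀ k, Ω k) → ℝ} {i k : ℕ} (hk : 0 < k) {M : ℝ} (hM0 : 0 ≤ M)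
    (hM : ∀ S : Finset (Fin d), S.card ≤ i → ∀ y, 0 < X.weight y →
      X.avg S (fun x => f x ^ 2) y ≤ M ^ 2)
    {T : Finset (Fin d)} (hT : T.card ≤ i * k)
    {P : (∀ k, Ω k) → ℝ} (hP0 : ∀ x, 0 ≤ P x) (hP : DependsOn P T) :
    (X.expect fun x => P x * X.energy f i x) ≤
      2 * (12 * k) ^ i * (M ^ 2 * X.expect P + 32 ^ d * γ * M * X.l2 f * X.l2 P) := by
  classical
  have hPn := X.l2_nonneg P
  have hfn := X.l2_nonneg f
  have hE0 : 0 ≤ X.expect P := X.expect_nonneg fun x _ => hP0 x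
  set G : Finset (Fin d) → Finset (Fin d) → ℝ := fun R W =>
    2 ^ R.card * ∑ R' ∈ R.powerset, X.expect fun x => P x * X.comp R' W f x ^ 2 with hG
  set 𝒲 : Finset (Fin d) → Finset (Finset (Fin d)) := fun R =>
    univ.filter fun W => Disjoint W T ∧ (R ∪ W).card ≤ i with h𝒲
  have hterm : ∀ S, (X.expect fun x => P x * X.comp ∅ S f x ^ 2) ≤ G (S ∩ T) (S \ T) := by
    intro S
    simp only [hG, ← expect_sum, ← expect_const_mul]
    refine X.expect_mono fun x _ => ?_
    rw [← mul_sum, mul_left_comm]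
    exact mul_le_mul_of_nonneg_left (X.comp_empty_sq_le S T f x) (hP0 x)
  have hreindex : ∑ S with S.card ≤ i, G (S ∩ T) (S \ T) =
      ∑ R ∈ T.powerset with R.card ≤ i, ∑ W ∈ 𝒲 R, G R W := by
    rw [sum_sigma']
    refine sum_bij' (fun S _ => ⟨S ∩ T, S \ T⟩) (fun p _ => p.1 ∪ p.2) ?_ ?_ ?_ ?_ ?_
    · intro S hS
      simp only [mem_filter, mem_univ, true_and] at hS
      simp only [h𝒲, mem_sigma, mem_filter, mem_powerset, mem_univ, true_and]
      refine ⟨⟨inter_subset_right, (card_le_card inter_subset_left).trans hS⟩, sdiff_disjoint, ?_⟩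
      rwa [union_comm, sdiff_union_inter]
    · rintro ⟨R, W⟩ h
      simp only [h𝒲, mem_sigma, mem_filter, mem_powerset, mem_univ, true_and] at h ⊢
      exact h.2.2
    · intro S _
      simp only
      rw [union_comm, sdiff_union_inter]
    · rintro ⟨R, W⟩ h
      simp only [h𝒲, mem_sigma, mem_filter, mem_powerset, mem_univ, true_and] at h
      have e1 : (R ∪ W) ∩ T = R := by
        rw [union_inter_distrib_right, inter_eq_left.2 h.1.1,
          disjoint_iff_inter_eq_empty.1 h.2.1, union_empty]
      have e2 : (R ∪ W) \ T = W := by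
        rw [union_sdiff_distrib, sdiff_eq_empty_iff_subset.2 h.1.1, empty_union,
          sdiff_eq_self_of_disjoint h.2.1]
      simp only [e1, e2]
    · intro S _
      rfl
  set A : ℝ := 2 * M ^ 2 * X.expect P + 32 ^ d * γ * M * X.l2 f * X.l2 P with hA
  have hA0 : 0 ≤ A := by positivity
  calc (X.expect fun x => P x * X.energy f i x)
      = ∑ S with S.card ≤ i, X.expect fun x => P x * X.comp ∅ S f x ^ 2 := by
        rw [← expect_sum]
        simp only [energy, mul_sum]
    _ ≤ ∑ S with S.card ≤ i, G (S ∩ T) (S \ T) := sum_le_sum fun S _ => hterm S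
    _ = ∑ R ∈ T.powerset with R.card ≤ i, ∑ W ∈ 𝒲 R, G R W := hreindex
    _ ≤ ∑ R ∈ T.powerset with R.card ≤ i, 4 ^ R.card * A := by
        refine sum_le_sum fun R hR => ?_
        simp only [mem_filter, mem_powerset] at hR
        calc ∑ W ∈ 𝒲 R, G R W = 2 ^ R.card * ∑ R' ∈ R.powerset, ∑ W ∈ 𝒲 R,
              X.expect fun x => P x * X.comp R' W f x ^ 2 := by
              simp only [hG]
              rw [← mul_sum, sum_comm]
          _ ≤ 2 ^ R.card * ∑ R' ∈ R.powerset, A := by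
              refine mul_le_mul_of_nonneg_left (sum_le_sum fun R' hR' => ?_) (by positivity)
              rw [mem_powerset] at hR'
              refine hX.sum_expect_mul_comp_sq_le hγ hγd hM0 hM (hR'.trans hR.1)
                ((card_le_card hR').trans hR.2) (fun W hW => ?_) hP0 hP
              simp only [h𝒲, mem_filter, mem_univ, true_and] at hW
              exact ⟨hW.1, (card_le_card (union_subset_union_left hR')).trans hW.2⟩
          _ = 4 ^ R.card * A := by
              rw [sum_const, card_powerset, nsmul_eq_mul, ← mul_assoc]
              push_cast
              rw [← mul_pow]
              norm_num
    _ = (∑ R ∈ T.powerset with R.card ≤ i, 4 ^ R.card) * A := by rw [sum_mul]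
    _ ≤ (12 * k) ^ i * A :=
        mul_le_mul_of_nonneg_right (sum_powerset_four_pow_card_le hk hT) hA0
    _ ≤ (12 * k) ^ i * (2 * (M ^ 2 * X.expect P + 32 ^ d * γ * M * X.l2 f * X.l2 P)) := by
        refine mul_le_mul_of_nonneg_left ?_ (by positivity)
        have : 0 ≤ 32 ^ d * γ * M * X.l2 f * X.l2 P := by positivity
        rw [hA]
        linarith
    _ = _ := by ring

/-- One factor of the energy is integrated out at a time, each against a junta. -/
theorem IsGammaProduct.expect_mul_energy_pow_le (hγ : 0 ≤ γ) (hX : X.IsGammaProduct γ)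
    (hγd : 3 * 64 ^ d * γ ≤ 1) {f : (∀ k, Ω k) → ℝ} {i k : ℕ} (hk : 0 < k) {M : ℝ} (hM0 : 0 ≤ M)
    (hM : ∀ S : Finset (Fin d), S.card ≤ i → ∀ y, 0 < X.weight y →
      X.avg S (fun x => f x ^ 2) y ≤ M ^ 2)
    {D : ℝ} (hD : 32 ^ d ≤ D) (hkD : 2 * (12 * k) ^ i ≤ D) (m : ℕ) :
    ∀ (T : Finset (Fin d)), T.card + i * m ≤ i * k →
    ∀ P : (∀ k, Ω k) → ℝ, (∀ x, 0 ≤ P x) → DependsOn P T →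
    ∀ L : ℝ, X.l2 P ≤ M * L → 0 ≤ L →
      (X.expect fun x => P x * X.energy f i x ^ m) ≤
        (2 * (12 * k) ^ i * M ^ 2) ^ m * X.expect P +
          m * D ^ (m + 1) * M ^ (2 * m) * γ * X.l2 f * L := by
  classical
  have hfn := X.l2_nonneg f
  have hD0 : 0 ≤ D := le_trans (by positivity) hD
  have hD8 : 8 ^ d ≤ D := (pow_le_pow_left₀ (by norm_num) (by norm_num) d).trans hD
  set β : ℝ := 2 * (12 * k) ^ i with hβ
  have hβ0 : 0 ≤ β := by positivity
  induction m with
  | zero =>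
    intro T _ P _ _ L _ _
    simp
  | succ m ih =>
    intro T hT P hP0 hP L hL hL0
    have hT' : T.card ≤ i * k := le_trans (Nat.le_add_right _ _) hT
    have hbase := hX.expect_mul_energy_le hγ hγd hk hM0 hM hT' hP0 hP
    rw [← hβ] at hbase
    have hterm : ∀ S ∈ univ.filter (fun S : Finset (Fin d) => S.card ≤ i),
        (X.expect fun x => (P x * X.comp ∅ S f x ^ 2) * X.energy f i x ^ m) ≤
          (β * M ^ 2) ^ m * (X.expect fun x => P x * X.comp ∅ S f x ^ 2) +
            m * D ^ (m + 1) * M ^ (2 * m) * γ * X.l2 f * (4 ^ d * M ^ 2 * L) := by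
      intro S hS
      have hS : S.card ≤ i := (mem_filter.1 hS).2
      refine ih (T ∪ S) ?_ _ (fun x => mul_nonneg (hP0 x) (sq_nonneg _)) ?_ _ ?_ (by positivity)
      · have := card_union_le T S
        rw [mul_add, mul_one] at hT
        omega
      · intro x y h
        simp only
        rw [hP.mono (coe_subset.2 subset_union_left) h, (X.comp_dependsOn ∅ S f).mono
          (coe_subset.2 (by rw [empty_union]; exact subset_union_right)) h]
      · calc X.l2 (fun x => P x * X.comp ∅ S f x ^ 2) ≤ (2 ^ d * M) ^ 2 * X.l2 P := by
              refine X.l2_le_mul (by positivity) fun x hx => ?_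
              rw [abs_mul, mul_comm, abs_pow]
              refine mul_le_mul_of_nonneg_right (pow_le_pow_left₀ (abs_nonneg _)
                (X.abs_comp_le hM0 hM ?_ hx) 2) (abs_nonneg _)
              rwa [empty_union]
          _ ≤ (2 ^ d * M) ^ 2 * (M * L) := by gcongr
          _ = M * (4 ^ d * M ^ 2 * L) := by
              rw [show (4 : ℝ) = 2 * 2 by norm_num, mul_pow, mul_pow]
              ring
    calc (X.expect fun x => P x * X.energy f i x ^ (m + 1))
        = ∑ S with S.card ≤ i,
            X.expect fun x => (P x * X.comp ∅ S f x ^ 2) * X.energy f i x ^ m := by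
          rw [← expect_sum]
          congr 1
          funext x
          rw [← sum_mul, ← mul_sum, ← energy, pow_succ]
          ring
      _ ≤ ∑ S with S.card ≤ i, ((β * M ^ 2) ^ m * (X.expect fun x => P x * X.comp ∅ S f x ^ 2) +
            m * D ^ (m + 1) * M ^ (2 * m) * γ * X.l2 f * (4 ^ d * M ^ 2 * L)) :=
          sum_le_sum hterm
      _ = (β * M ^ 2) ^ m * (X.expect fun x => P x * X.energy f i x) +
            (univ.filter fun S : Finset (Fin d) => S.card ≤ i).card *
              (m * D ^ (m + 1) * M ^ (2 * m) * γ * X.l2 f * (4 ^ d * M ^ 2 * L)) := by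
          rw [sum_add_distrib, ← mul_sum, ← expect_sum]
          simp only [energy, mul_sum, sum_const, nsmul_eq_mul]
      _ ≤ (β * M ^ 2) ^ m * (β * (M ^ 2 * X.expect P + 32 ^ d * γ * M * X.l2 f * (M * L))) +
            2 ^ d * (m * D ^ (m + 1) * M ^ (2 * m) * γ * X.l2 f * (4 ^ d * M ^ 2 * L)) := by
          refine add_le_add (mul_le_mul_of_nonneg_left (hbase.trans ?_) (by positivity))
            (mul_le_mul_of_nonneg_right (card_finset_le _) (by positivity))
          gcongr
      _ = (β * M ^ 2) ^ (m + 1) * X.expect P + (β ^ (m + 1) * 32 ^ d +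
            m * 8 ^ d * D ^ (m + 1)) * (M ^ (2 * (m + 1)) * γ * X.l2 f * L) := by
          rw [show (8 : ℝ) = 2 * 4 by norm_num, mul_pow 2 4]
          ring
      _ ≤ (β * M ^ 2) ^ (m + 1) * X.expect P + (D ^ (m + 1) * D +
            m * D * D ^ (m + 1)) * (M ^ (2 * (m + 1)) * γ * X.l2 f * L) := by
          gcongr
      _ = _ := by
          push_cast
          ring

/-- The moments of the energy in terms of its mean. -/
theorem IsGammaProduct.expect_energy_pow_le (hγ : 0 ≤ γ) (hX : X.IsGammaProduct γ)
    (hγd : 3 * 64 ^ d * γ ≤ 1) {f : (∀ k, Ω k) → ℝ} {i m : ℕ} {M : ℝ} (hM0 : 0 ≤ M)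
    (hM : ∀ S : Finset (Fin d), S.card ≤ i → ∀ y, 0 < X.weight y →
      X.avg S (fun x => f x ^ 2) y ≤ M ^ 2)
    {D : ℝ} (hD : 32 ^ d ≤ D) (hkD : 2 * (12 * (m + 1 : ℕ)) ^ i ≤ D) :
    (X.expect fun x => X.energy f i x ^ (m + 1)) ≤
      (2 * (12 * (m + 1 : ℕ)) ^ i * M ^ 2) ^ m * X.expect (X.energy f i) +
        m * D ^ (m + 2) * M ^ (2 * m) * γ * X.l2 f ^ 2 := by
  classical
  have hfn := X.l2_nonneg f
  have hD0 : 0 ≤ D := le_trans (by positivity) hD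
  have hD8 : 8 ^ d ≤ D := (pow_le_pow_left₀ (by norm_num) (by norm_num) d).trans hD
  set β : ℝ := 2 * (12 * (m + 1 : ℕ)) ^ i with hβ
  have hterm : ∀ S ∈ univ.filter (fun S : Finset (Fin d) => S.card ≤ i),
      (X.expect fun x => X.comp ∅ S f x ^ 2 * X.energy f i x ^ m) ≤
        (β * M ^ 2) ^ m * (X.expect fun x => X.comp ∅ S f x ^ 2) +
          m * D ^ (m + 1) * M ^ (2 * m) * γ * X.l2 f * (4 ^ d * X.l2 f) := by
    intro S hS
    have hS : S.card ≤ i := (mem_filter.1 hS).2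
    refine hX.expect_mul_energy_pow_le hγ hγd (Nat.succ_pos m) hM0 hM hD hkD m S ?_ _
      (fun x => sq_nonneg _) ?_ _ ?_ (by positivity)
    · rw [Nat.succ_eq_add_one, mul_add, mul_one]
      omega
    · intro x y h
      simp only
      rw [(X.comp_dependsOn ∅ S f).mono (coe_subset.2 (by rw [empty_union])) h]
    · calc X.l2 (fun x => X.comp ∅ S f x ^ 2) ≤ (2 ^ d * M) * X.l2 (X.comp ∅ S f) := by
            refine X.l2_le_mul (by positivity) fun x hx => ?_
            rw [abs_pow, sq]
            refine mul_le_mul_of_nonneg_right (X.abs_comp_le hM0 hM ?_ hx) (abs_nonneg _)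
            rwa [empty_union]
        _ ≤ (2 ^ d * M) * (2 ^ d * X.l2 f) := by
            gcongr
            exact X.l2_comp_le ∅ S f
        _ = M * (4 ^ d * X.l2 f) := by
            rw [show (4 : ℝ) = 2 * 2 by norm_num, mul_pow]
            ring
  calc (X.expect fun x => X.energy f i x ^ (m + 1))
      = ∑ S with S.card ≤ i, X.expect fun x => X.comp ∅ S f x ^ 2 * X.energy f i x ^ m := by
        rw [← expect_sum]
        congr 1
        funext x
        rw [← sum_mul, ← energy, pow_succ]
        ring
    _ ≤ ∑ S with S.card ≤ i, ((β * M ^ 2) ^ m * (X.expect fun x => X.comp ∅ S f x ^ 2) +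
          m * D ^ (m + 1) * M ^ (2 * m) * γ * X.l2 f * (4 ^ d * X.l2 f)) := sum_le_sum hterm
    _ = (β * M ^ 2) ^ m * X.expect (X.energy f i) +
          (univ.filter fun S : Finset (Fin d) => S.card ≤ i).card *
            (m * D ^ (m + 1) * M ^ (2 * m) * γ * X.l2 f * (4 ^ d * X.l2 f)) := by
        rw [sum_add_distrib, ← mul_sum, ← expect_sum, sum_const, nsmul_eq_mul]
        rfl
    _ ≤ (β * M ^ 2) ^ m * X.expect (X.energy f i) +
          2 ^ d * (m * D ^ (m + 1) * M ^ (2 * m) * γ * X.l2 f * (4 ^ d * X.l2 f)) := by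
        gcongr
        exact card_finset_le _
    _ = (β * M ^ 2) ^ m * X.expect (X.energy f i) +
          8 ^ d * (m * D ^ (m + 1) * M ^ (2 * m) * γ * X.l2 f ^ 2) := by
        rw [show (8 : ℝ) = 2 * 4 by norm_num, mul_pow 2 4]
        ring
    _ ≤ (β * M ^ 2) ^ m * X.expect (X.energy f i) +
          D * (m * D ^ (m + 1) * M ^ (2 * m) * γ * X.l2 f ^ 2) := by
        gcongr
    _ = _ := by ring

/-! ### A hypercontractive inequality for a biased coin -/

/-- The two-point inequality for a fair sign. -/
theorem add_pow_add_sub_pow_le (A B : ℝ) (k : ℕ) : ∀ n : ℝ, 8 * k ≤ n →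
    (A + B) ^ (2 * k) + (A - B) ^ (2 * k) ≤ 2 * (A ^ 2 + n * B ^ 2) ^ k := by
  have hP : 0 ≤ (A + B) ^ 2 := sq_nonneg _
  have hR : 0 ≤ (A - B) ^ 2 := sq_nonneg _
  simp only [pow_mul]
  set P := (A + B) ^ 2 with hPdef
  set R := (A - B) ^ 2 with hRdef
  induction k using Nat.strong_induction_on with
  | _ k ih =>
  intro n hn
  match k with
  | 0 => norm_num
  | 1 =>
    push_cast at hn
    rw [hPdef, hRdef]
    nlinarith [sq_nonneg B]
  | k + 2 =>
    push_cast at hn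
    set Y := A ^ 2 + n * B ^ 2 with hY
    have hk : (0 : ℝ) ≤ k := Nat.cast_nonneg k
    have hY0 : 0 ≤ Y := add_nonneg (sq_nonneg A) (mul_nonneg (by linarith) (sq_nonneg B))
    have h1 := ih (k + 1) (by omega) n (by push_cast; linarith)
    have h0 := ih k (by omega) n (by linarith)
    have hdiff : (P - R) * (P ^ (k + 1) - R ^ (k + 1)) ≤
        (P - R) ^ 2 * ((k + 1) * (P ^ k + R ^ k)) := by
      have h := abs_pow_sub_pow_le P R (k + 1)
      rw [abs_of_nonneg hP, abs_of_nonneg hR, Nat.add_sub_cancel] at h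
      have hmax : max P R ^ k ≤ P ^ k + R ^ k := by
        rcases max_choice P R with h | h <;> rw [h]
        · linarith [pow_nonneg hR k]
        · linarith [pow_nonneg hP k]
      calc (P - R) * (P ^ (k + 1) - R ^ (k + 1))
          ≤ |P - R| * |P ^ (k + 1) - R ^ (k + 1)| := by
            rw [← abs_mul]
            exact le_abs_self _
        _ ≤ |P - R| * (|P - R| * (k + 1 : ℕ) * (P ^ k + R ^ k)) := by
            refine mul_le_mul_of_nonneg_left (h.trans ?_) (abs_nonneg _)
            gcongr
        _ = _ := by
            rw [← sq_abs (P - R)]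
            push_cast
            ring
    have hPR : (P - R) ^ 2 = 16 * (A ^ 2 * B ^ 2) := by
      rw [hPdef, hRdef]
      ring
    have hPR' : P + R = 2 * (A ^ 2 + B ^ 2) := by
      rw [hPdef, hRdef]
      ring
    have e : P ^ (k + 2) + R ^ (k + 2) = (P + R) / 2 * (P ^ (k + 1) + R ^ (k + 1)) +
        (P - R) * (P ^ (k + 1) - R ^ (k + 1)) / 2 := by ring
    calc P ^ (k + 2) + R ^ (k + 2)
        ≤ (A ^ 2 + B ^ 2) * (2 * Y ^ (k + 1)) +
          8 * (A ^ 2 * B ^ 2) * ((k + 1) * (2 * Y ^ k)) := by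
          rw [e, hPR']
          have := mul_le_mul_of_nonneg_left h1 (by positivity : 0 ≤ A ^ 2 + B ^ 2)
          have := mul_le_mul_of_nonneg_left h0
            (by positivity : 0 ≤ 8 * (A ^ 2 * B ^ 2) * ((k : ℝ) + 1))
          rw [hPR] at hdiff
          linarith
      _ = 2 * Y ^ k * ((A ^ 2 + B ^ 2) * Y + B ^ 2 * (8 * (k + 1) * A ^ 2)) := by ring
      _ ≤ 2 * Y ^ k * ((A ^ 2 + B ^ 2) * Y + B ^ 2 * ((n - 1) * Y)) := by
          have : 8 * (k + 1) * A ^ 2 ≤ (n - 1) * Y := by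
            have : A ^ 2 ≤ Y := by
              rw [hY]
              nlinarith [sq_nonneg B]
            have := mul_le_mul (by linarith : 8 * ((k : ℝ) + 1) ≤ n - 1) this (sq_nonneg A)
              (by linarith)
            linarith
          gcongr
      _ = 2 * Y ^ (k + 2) := by
          rw [hY]
          ring

/-- The two-point inequality for the biased sign that takes the values `2` and `-1` with
probabilities `1/3` and `2/3`: by convexity the fair sign with values `±3` dominates it. -/
theorem biased_two_point (A B : ℝ) (k : ℕ) :
    2 / 3 * (A - B) ^ (2 * k) + 1 / 3 * (A + 2 * B) ^ (2 * k) ≤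
      (A ^ 2 + 72 * k * B ^ 2) ^ k := by
  have hc : ConvexOn ℝ Set.univ fun x : ℝ => x ^ (2 * k) := (even_two_mul k).convexOn_pow
  have h1 := hc.2 (Set.mem_univ (A - 3 * B)) (Set.mem_univ (A + 3 * B))
    (by norm_num : (0 : ℝ) ≤ 2 / 3) (by norm_num : (0 : ℝ) ≤ 1 / 3) (by norm_num)
  have h2 := hc.2 (Set.mem_univ (A - 3 * B)) (Set.mem_univ (A + 3 * B))
    (by norm_num : (0 : ℝ) ≤ 1 / 6) (by norm_num : (0 : ℝ) ≤ 5 / 6) (by norm_num)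
  simp only [smul_eq_mul] at h1 h2
  rw [show 2 / 3 * (A - 3 * B) + 1 / 3 * (A + 3 * B) = A - B by ring] at h1
  rw [show 1 / 6 * (A - 3 * B) + 5 / 6 * (A + 3 * B) = A + 2 * B by ring] at h2
  have h3 := add_pow_add_sub_pow_le A (3 * B) k (8 * k) le_rfl
  rw [show A ^ 2 + 8 * k * (3 * B) ^ 2 = A ^ 2 + 72 * k * B ^ 2 by ring] at h3
  linarith

/-- Minkowski's inequality for a weighted finite sum and an integral exponent. -/
theorem sum_weight_mul_add_pow_le {α : Type*} (s : Finset α) {w u v : α → ℝ}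
    (hw : ∀ a ∈ s, 0 ≤ w a) (hu : ∀ a ∈ s, 0 ≤ u a) (hv : ∀ a ∈ s, 0 ≤ v a) {k : ℕ} (hk : 0 < k)
    {p r : ℝ} (hp : 0 ≤ p) (hr : 0 ≤ r) (h1 : ∑ a ∈ s, w a * u a ^ k ≤ p ^ k)
    (h2 : ∑ a ∈ s, w a * v a ^ k ≤ r ^ k) :
    ∑ a ∈ s, w a * (u a + v a) ^ k ≤ (p + r) ^ k := by
  have hk1 : (1 : ℝ) ≤ k := Nat.one_le_cast.2 hk
  have hw' : ∀ a ∈ s, (w a ^ (k : ℝ)⁻¹) ^ k = w a := fun a ha =>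
    Real.rpow_inv_natCast_pow (hw a ha) hk.ne'
  have h := Real.Lp_add_le_of_nonneg (s := s) (f := fun a => w a ^ (k : ℝ)⁻¹ * u a)
    (g := fun a => w a ^ (k : ℝ)⁻¹ * v a) hk1
    (fun a ha => mul_nonneg (Real.rpow_nonneg (hw a ha) _) (hu a ha))
    (fun a ha => mul_nonneg (Real.rpow_nonneg (hw a ha) _) (hv a ha))
  have root : ∀ {x y : ℝ}, 0 ≤ x → 0 ≤ y → x ≤ y ^ k → x ^ (1 / (k : ℝ)) ≤ y :=
    fun hx hy hxy => by
      rw [one_div]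
      calc _ ≤ (_ ^ k) ^ (k : ℝ)⁻¹ := Real.rpow_le_rpow hx hxy (by positivity)
        _ = _ := Real.pow_rpow_inv_natCast hy hk.ne'
  simp only [Real.rpow_natCast, ← mul_add, mul_pow] at h
  have e : ∀ f : α → ℝ, ∑ a ∈ s, (w a ^ (k : ℝ)⁻¹) ^ k * f a = ∑ a ∈ s, w a * f a := fun f =>
    sum_congr rfl fun a ha => by rw [hw' a ha]
  rw [e, e, e] at h
  have n1 : 0 ≤ ∑ a ∈ s, w a * u a ^ k :=
    sum_nonneg fun a ha => mul_nonneg (hw a ha) (pow_nonneg (hu a ha) k)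
  have n2 : 0 ≤ ∑ a ∈ s, w a * v a ^ k :=
    sum_nonneg fun a ha => mul_nonneg (hw a ha) (pow_nonneg (hv a ha) k)
  have n3 : 0 ≤ ∑ a ∈ s, w a * (u a + v a) ^ k :=
    sum_nonneg fun a ha => mul_nonneg (hw a ha) (pow_nonneg (add_nonneg (hu a ha) (hv a ha)) k)
  have h' := h.trans (add_le_add (root n1 hp h1) (root n2 hr h2))
  calc _ = ((∑ a ∈ s, w a * (u a + v a) ^ k) ^ (1 / (k : ℝ))) ^ k := by
        rw [one_div, Real.rpow_inv_natCast_pow n3 hk.ne']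
    _ ≤ (p + r) ^ k := pow_le_pow_left₀ (Real.rpow_nonneg n3 _) h' k

section Biased

variable {ι : Type*} [DecidableEq ι]

/-- The expectation of `F B` over the random set `B ⊆ s` that contains each element independently
with probability `1/3`. -/
noncomputable def biasedExpect (s : Finset ι) (F : Finset ι → ℝ) : ℝ :=
  ∑ B ∈ s.powerset, ((1 / 3) ^ B.card * (2 / 3) ^ (s \ B).card) * F B

/-- The centred biased sign at `e`: `2` on the sets containing `e`, and `-1` on the others. -/
noncomputable def biasedSign (B : Finset ι) (e : ι) : ℝ := if e ∈ B then 2 else -1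

/-- The multilinear polynomial in the biased signs with coefficients `a`. -/
noncomputable def biasedPoly (a : Finset ι → ℝ) (s B : Finset ι) : ℝ :=
  ∑ S ∈ s.powerset, a S * ∏ e ∈ S, biasedSign B e

theorem biasedExpect_insert {s : Finset ι} {e : ι} (he : e ∉ s) (F : Finset ι → ℝ) :
    biasedExpect (insert e s) F =
      biasedExpect s fun B => 2 / 3 * F B + 1 / 3 * F (insert e B) := by
  unfold biasedExpect
  rw [sum_powerset_insert he, ← sum_add_distrib]
  refine sum_congr rfl fun B hB => ?_
  have heB : e ∉ B := fun h => he (mem_powerset.1 hB h)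
  rw [insert_sdiff_insert, sdiff_insert_of_notMem he, insert_sdiff_of_notMem _ heB,
    card_insert_of_notMem heB, card_insert_of_notMem (by simp [he])]
  ring

theorem biasedExpect_mono {s : Finset ι} {F G : Finset ι → ℝ} (h : ∀ B ⊆ s, F B ≤ G B) :
    biasedExpect s F ≤ biasedExpect s G :=
  sum_le_sum fun B hB => mul_le_mul_of_nonneg_left (h B (mem_powerset.1 hB)) (by positivity)

theorem biasedPoly_insert {s : Finset ι} {e : ι} (he : e ∉ s) (a : Finset ι → ℝ)
    (B : Finset ι) : biasedPoly a (insert e s) B =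
      biasedPoly a s B + biasedSign B e * biasedPoly (fun S => a (insert e S)) s B := by
  unfold biasedPoly
  rw [sum_powerset_insert he, mul_sum]
  congr 1
  refine sum_congr rfl fun S hS => ?_
  rw [prod_insert fun h => he (mem_powerset.1 hS h)]
  ring

theorem biasedPoly_insert_right {s : Finset ι} {e : ι} (he : e ∉ s) (a : Finset ι → ℝ)
    (B : Finset ι) : biasedPoly a s (insert e B) = biasedPoly a s B := by
  refine sum_congr rfl fun S hS => ?_
  congr 1
  refine prod_congr rfl fun j hj => ?_
  have hne : j ≠ e := fun h => he (h ▸ mem_powerset.1 hS hj)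
  simp [biasedSign, hne]

/-- Hypercontractivity for biased signs. -/
theorem biasedExpect_poly_pow_le {k : ℕ} (hk : 0 < k) (s : Finset ι) :
    ∀ a : Finset ι → ℝ, (biasedExpect s fun B => biasedPoly a s B ^ (2 * k)) ≤
      (∑ S ∈ s.powerset, (72 * k) ^ S.card * a S ^ 2) ^ k := by
  induction s using Finset.induction_on with
  | empty =>
    intro a
    simp [biasedExpect, biasedPoly, pow_mul]
  | insert e s he ih =>
    intro a
    rw [biasedExpect_insert he, sum_powerset_insert he]
    set a' : Finset ι → ℝ := fun S => a (insert e S) with ha'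
    have h2 : ∑ S ∈ s.powerset, (72 * k : ℝ) ^ (insert e S).card * a (insert e S) ^ 2 =
        72 * k * ∑ S ∈ s.powerset, (72 * k : ℝ) ^ S.card * a' S ^ 2 := by
      rw [mul_sum]
      refine sum_congr rfl fun S hS => ?_
      rw [card_insert_of_notMem fun h => he (mem_powerset.1 hS h)]
      ring
    rw [h2]
    refine (biasedExpect_mono (G := fun B =>
      (biasedPoly a s B ^ 2 + 72 * k * biasedPoly a' s B ^ 2) ^ k) fun B hB => ?_).trans ?_
    · have heB : e ∉ B := fun h => he (hB h)
      refine le_trans (le_of_eq ?_) (biased_two_point (biasedPoly a s B) (biasedPoly a' s B) k)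
      rw [biasedPoly_insert he, biasedPoly_insert he, biasedPoly_insert_right he,
        biasedPoly_insert_right he]
      simp only [biasedSign, heB, if_false, mem_insert_self, if_true]
      ring
    · refine sum_weight_mul_add_pow_le _ (fun _ _ => by positivity) (fun _ _ => sq_nonneg _)
        (fun _ _ => by positivity) hk (sum_nonneg fun _ _ => by positivity)
        (mul_nonneg (by positivity) (sum_nonneg fun _ _ => by positivity)) ?_ ?_
      · simpa only [biasedExpect, pow_mul] using ih a
      · have h := mul_le_mul_of_nonneg_left (ih a') (by positivity : (0 : ℝ) ≤ (72 * k) ^ k)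
        rw [← mul_pow] at h
        refine le_trans (le_of_eq ?_) h
        rw [biasedExpect, mul_sum]
        refine sum_congr rfl fun B _ => ?_
        rw [mul_pow, pow_mul]
        ring

/-- The `m`-th moment of a biased sign is nonnegative, and at least `1` unless `m = 1`. -/
theorem biased_moment (m : ℕ) :
    (0 : ℝ) ≤ 1 / 3 * 2 ^ m + 2 / 3 * (-1) ^ m ∧
      (m ≠ 1 → (1 : ℝ) ≤ 1 / 3 * 2 ^ m + 2 / 3 * (-1) ^ m) := by
  match m with
  | 0 => norm_num
  | 1 => norm_num
  | 2 => norm_num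
  | m + 3 =>
    have h1 : (1 : ℝ) ≤ 2 ^ m := one_le_pow₀ one_le_two
    have h2 : (-1 : ℝ) ≤ (-1) ^ (m + 3) := by
      rcases neg_one_pow_eq_or ℝ (m + 3) with h | h <;> rw [h]
      norm_num
    have h3 : (2 : ℝ) ^ (m + 3) = 8 * 2 ^ m := by ring
    rw [h3]
    exact ⟨by linarith, fun _ => by linarith⟩

/-- A sum over the tuples of sets in which no element is covered exactly once: the biased signs
have mean zero and higher moments at least `1`, so that it is at most the moment of a polynomial
in them. -/
theorem sum_prod_filter_cover_le [Fintype ι] {a : Finset ι → ℝ} (ha : ∀ S, 0 ≤ a S) {k : ℕ}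
    (hk : 0 < k) :
    ∑ σ : Fin (2 * k) → Finset ι with ∀ e, (univ.filter fun j => e ∈ σ j).card ≠ 1,
      ∏ j, a (σ j) ≤ (∑ S, (72 * k) ^ S.card * a S ^ 2) ^ k := by
  have h := biasedExpect_poly_pow_le hk univ a
  rw [powerset_univ] at h
  refine le_trans ?_ h
  have hmom : ∀ σ : Fin (2 * k) → Finset ι,
      (biasedExpect univ fun B => ∏ j, ∏ e ∈ σ j, biasedSign B e) =
        ∏ e, (1 / 3 * 2 ^ (univ.filter fun j => e ∈ σ j).card +
          2 / 3 * (-1 : ℝ) ^ (univ.filter fun j => e ∈ σ j).card) := by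
    intro σ
    rw [prod_add]
    refine sum_congr rfl fun B _ => ?_
    have e1 : ∏ j, ∏ e ∈ σ j, biasedSign B e =
        ∏ e, biasedSign B e ^ (univ.filter fun j => e ∈ σ j).card := by
      simp only [← prod_const, prod_filter]
      rw [prod_comm]
      refine prod_congr rfl fun j _ => ?_
      rw [prod_ite_mem, univ_inter]
    have e2 : ∏ e, biasedSign B e ^ (univ.filter fun j => e ∈ σ j).card =
        (∏ e ∈ B, (2 : ℝ) ^ (univ.filter fun j => e ∈ σ j).card) *
          ∏ e ∈ univ \ B, (-1 : ℝ) ^ (univ.filter fun j => e ∈ σ j).card := by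
      rw [← prod_sdiff (subset_univ B), mul_comm]
      congr 1
      · exact prod_congr rfl fun e he => by rw [biasedSign, if_pos he]
      · exact prod_congr rfl fun e he => by rw [biasedSign, if_neg (mem_sdiff.1 he).2]
    simp only [e1, e2, prod_mul_distrib, prod_const]
    ring
  have hexp : (biasedExpect univ fun B => biasedPoly a univ B ^ (2 * k)) =
      ∑ σ : Fin (2 * k) → Finset ι, (∏ j, a (σ j)) *
        biasedExpect univ fun B => ∏ j, ∏ e ∈ σ j, biasedSign B e := by
    simp only [biasedExpect, biasedPoly, powerset_univ, Fintype.sum_pow, prod_mul_distrib, mul_sum]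
    rw [sum_comm]
    exact sum_congr rfl fun σ _ => sum_congr rfl fun B _ => by ring
  rw [hexp]
  refine (sum_le_sum fun σ hσ => ?_).trans
    (sum_le_sum_of_subset_of_nonneg (filter_subset _ _) fun σ _ _ => ?_)
  · rw [hmom]
    refine le_mul_of_one_le_right (prod_nonneg fun j _ => ha _) ?_
    have h1 := prod_le_prod (s := univ) (f := fun _ : ι => (1 : ℝ)) (fun _ _ => zero_le_one)
      fun e _ => (biased_moment _).2 ((mem_filter.1 hσ).2 e)
    simpa using h1
  · rw [hmom]
    exact mul_nonneg (prod_nonneg fun j _ => ha _) (prod_nonneg fun e _ => (biased_moment _).1)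

end Biased

variable (X)

/-! ### Moments of the low-degree part -/

theorem lowDegree_eq (f : (∀ k, Ω k) → ℝ) (i : ℕ) (x : ∀ k, Ω k) :
    X.lowDegree f i x = ∑ S with S.card ≤ i, X.comp ∅ S f x := by
  simp only [lowDegree, comp_empty]

variable {X}

/-- The term of the expansion of a moment that belongs to a tuple of sets covering some element
exactly once is negligible: the component that covers it is nearly orthogonal to the product of
the others. -/
theorem IsGammaProduct.expect_prod_comp_le (hγ : 0 ≤ γ) (hX : X.IsGammaProduct γ)
    {f : (∀ k, Ω k) → ℝ} {i m : ℕ} {M : ℝ} (hM0 : 0 ≤ M)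
    (hM : ∀ S : Finset (Fin d), S.card ≤ i → ∀ y, 0 < X.weight y →
      X.avg S (fun x => f x ^ 2) y ≤ M ^ 2)
    {σ : Fin (2 * (m + 1)) → Finset (Fin d)} (hσi : ∀ j, (σ j).card ≤ i) {e : Fin d}
    (he : (univ.filter fun j => e ∈ σ j).card = 1) :
    (X.expect fun x => ∏ j, X.comp ∅ (σ j) f x) ≤
      16 ^ d * 4 ^ (d * m) * γ * X.l2 f ^ 2 * M ^ (2 * m) := by
  classical
  obtain ⟨j₀, hj₀⟩ := card_eq_one.1 he
  have hmem : ∀ j, e ∈ σ j ↔ j = j₀ := fun j => by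
    have h : j ∈ univ.filter (fun j => e ∈ σ j) ↔ j ∈ ({j₀} : Finset _) := by rw [hj₀]
    simpa using h
  set p : (∀ k, Ω k) → ℝ := fun x => ∏ j ∈ univ.erase j₀, X.comp ∅ (σ j) f x with hp
  set V : Finset (Fin d) := (univ.erase j₀).biUnion σ with hV
  have hpV : DependsOn p V := fun x y h => by
    refine prod_congr rfl fun j hj => (X.comp_dependsOn ∅ (σ j) f).mono (coe_subset.2 ?_) h
    rw [empty_union]
    exact subset_biUnion_of_mem σ hj
  have hnot : ¬σ j₀ ⊆ V := fun h => by
    obtain ⟨j, hj, hej⟩ := mem_biUnion.1 (h ((hmem j₀).2 rfl))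
    exact ne_of_mem_erase hj ((hmem j).1 hej)
  have hcard : (univ.erase j₀ : Finset (Fin (2 * (m + 1)))).card = 2 * m + 1 := by
    rw [card_erase_of_mem (mem_univ _), card_univ, Fintype.card_fin]
    omega
  obtain ⟨j₁, hj₁⟩ := card_pos.1 (by omega : 0 < (univ.erase j₀ : Finset (Fin (2 * (m + 1)))).card)
  have hfn := X.l2_nonneg f
  have hl2 : X.l2 p ≤ (2 ^ d * M) ^ (2 * m) * (2 ^ d * X.l2 f) := by
    refine (X.l2_le_mul (g := X.comp ∅ (σ j₁) f) (c := (2 ^ d * M) ^ (2 * m)) (by positivity)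
      fun x hx => ?_).trans
      (mul_le_mul_of_nonneg_left (X.l2_comp_le _ _ _) (by positivity))
    simp only [hp]
    rw [abs_prod, ← mul_prod_erase _ _ hj₁, mul_comm]
    refine mul_le_mul_of_nonneg_right ?_ (abs_nonneg _)
    refine (prod_le_prod (fun _ _ => abs_nonneg _) fun j _ =>
      X.abs_comp_le hM0 hM (by rw [empty_union]; exact hσi j) hx).trans (le_of_eq ?_)
    rw [prod_const, card_erase_of_mem hj₁, hcard, Nat.add_sub_cancel]
  have h := (le_abs_self _).trans (hX.abs_expect_comp_mul_le hγ (R := ∅) hnot f hpV)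
  calc (X.expect fun x => ∏ j, X.comp ∅ (σ j) f x)
      = X.expect fun x => X.comp ∅ (σ j₀) f x * p x := by
        refine X.expect_congr fun x _ => ?_
        rw [mul_prod_erase _ (fun j => X.comp ∅ (σ j) f x) (mem_univ j₀)]
    _ ≤ 8 ^ d * γ * (X.l2 f * X.l2 p) := h
    _ ≤ 8 ^ d * γ * (X.l2 f * ((2 ^ d * M) ^ (2 * m) * (2 ^ d * X.l2 f))) := by gcongr
    _ = _ := by
        have h4 : (4 : ℝ) ^ (d * m) = 2 ^ (2 * (d * m)) := by
          rw [pow_mul 2]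
          norm_num
        rw [show (16 : ℝ) = 8 * 2 by norm_num, h4, mul_pow 8 2]
        ring

theorem IsGammaProduct.expect_lowDegree_pow_le_energy (hγ : 0 ≤ γ) (hX : X.IsGammaProduct γ)
    {f : (∀ k, Ω k) → ℝ} {i m : ℕ} {M : ℝ} (hM0 : 0 ≤ M)
    (hM : ∀ S : Finset (Fin d), S.card ≤ i → ∀ y, 0 < X.weight y →
      X.avg S (fun x => f x ^ 2) y ≤ M ^ 2) :
    (X.expect fun x => X.lowDegree f i x ^ (2 * (m + 1))) ≤
      (72 * (m + 1 : ℕ)) ^ (i * (m + 1)) * (X.expect fun x => X.energy f i x ^ (m + 1)) +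
        4 ^ (d * (m + 1)) * (16 ^ d * 4 ^ (d * m) * γ * X.l2 f ^ 2 * M ^ (2 * m)) := by
  classical
  set η : ℝ := 16 ^ d * 4 ^ (d * m) * γ * X.l2 f ^ 2 * M ^ (2 * m) with hη
  have hη0 : 0 ≤ η := by positivity
  set u : Finset (Fin d) → (∀ k, Ω k) → ℝ := fun S x =>
    if S.card ≤ i then X.comp ∅ S f x else 0 with hu
  have hg : ∀ x, X.lowDegree f i x ^ (2 * (m + 1)) =
      ∑ σ : Fin (2 * (m + 1)) → Finset (Fin d), ∏ j, u (σ j) x := fun x => by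
    rw [X.lowDegree_eq, sum_filter, Fintype.sum_pow]
  set good : (Fin (2 * (m + 1)) → Finset (Fin d)) → Prop := fun σ =>
    ∀ e, (univ.filter fun j => e ∈ σ j).card ≠ 1 with hgood
  have hbad : ∀ σ, ¬good σ → (X.expect fun x => ∏ j, u (σ j) x) ≤ η := by
    intro σ hσ
    simp only [hgood, not_forall, not_not] at hσ
    obtain ⟨e, he⟩ := hσ
    by_cases hi : ∀ j, (σ j).card ≤ i
    · simp only [hu, hi, if_true]
      exact hX.expect_prod_comp_le hγ hM0 hM hi he
    · obtain ⟨j, hj⟩ := not_forall.1 hi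
      have h0 : ∀ x, ∏ j, u (σ j) x = 0 := fun x =>
        prod_eq_zero (mem_univ j) (by simp only [hu, hj, if_false])
      simp only [h0, expect_const]
      exact hη0
  have hpoint : ∀ x, ∑ σ with good σ, ∏ j, u (σ j) x ≤
      (72 * (m + 1 : ℕ)) ^ (i * (m + 1)) * X.energy f i x ^ (m + 1) := by
    intro x
    calc ∑ σ with good σ, ∏ j, u (σ j) x ≤ ∑ σ with good σ, ∏ j, |u (σ j) x| :=
          sum_le_sum fun σ _ => (le_abs_self _).trans (abs_prod _ _).le
      _ ≤ (∑ S, (72 * (m + 1 : ℕ)) ^ S.card * |u S x| ^ 2) ^ (m + 1) :=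
          by convert sum_prod_filter_cover_le (a := fun S => |u S x|) (fun _ => abs_nonneg _)
              m.succ_pos
      _ ≤ ((72 * (m + 1 : ℕ)) ^ i * X.energy f i x) ^ (m + 1) := by
          refine pow_le_pow_left₀ (sum_nonneg fun _ _ => by positivity) ?_ _
          rw [energy, mul_sum, sum_filter]
          refine sum_le_sum fun S _ => ?_
          simp only [hu]
          split_ifs with h
          · rw [sq_abs]
            refine mul_le_mul_of_nonneg_right (pow_le_pow_right₀ ?_ h) (sq_nonneg _)
            have : (1 : ℝ) ≤ (m + 1 : ℕ) := by simp
            linarith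
          · simp
      _ = _ := by rw [mul_pow, ← pow_mul]
  calc (X.expect fun x => X.lowDegree f i x ^ (2 * (m + 1)))
      = (X.expect fun x => ∑ σ with good σ, ∏ j, u (σ j) x) +
          ∑ σ with ¬good σ, X.expect fun x => ∏ j, u (σ j) x := by
        simp only [hg]
        rw [expect_sum, expect_sum, sum_filter_add_sum_filter_not]
    _ ≤ (X.expect fun x => (72 * (m + 1 : ℕ)) ^ (i * (m + 1)) * X.energy f i x ^ (m + 1)) +
          ∑ σ : Fin (2 * (m + 1)) → Finset (Fin d) with ¬good σ, η :=
        add_le_add (X.expect_mono fun x _ => hpoint x)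
          (sum_le_sum fun σ hσ => hbad σ (mem_filter.1 hσ).2)
    _ ≤ _ := by
        rw [expect_const_mul, sum_const, nsmul_eq_mul]
        gcongr
        have h : (univ.filter fun σ : Fin (2 * (m + 1)) → Finset (Fin d) => ¬good σ).card ≤
            4 ^ (d * (m + 1)) := by
          refine (card_le_univ _).trans (le_of_eq ?_)
          rw [Fintype.card_fun, Fintype.card_finset, Fintype.card_fin, Fintype.card_fin,
            ← pow_mul, show 4 = 2 ^ 2 by norm_num, ← pow_mul]
          congr 1
          ring
        exact_mod_cast h

theorem IsGammaProduct.expect_energy_le (hγ : 0 ≤ γ) (hX : X.IsGammaProduct γ)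
    (f : (∀ k, Ω k) → ℝ) (i : ℕ) :
    X.expect (X.energy f i) ≤ (X.expect fun x => X.lowDegree f i x ^ 2) +
      64 ^ d * γ * X.l2 f ^ 2 := by
  have h := (abs_le.1 (hX.abs_expect_sq_sum_comp_sub_le hγ (R := ∅)
    (𝒲 := univ.filter fun S => S.card ≤ i) (fun W _ => disjoint_empty_right W) f)).1
  simp only [← lowDegree_eq, ← expect_sum] at h
  have e : X.expect (X.energy f i) =
    X.expect fun x => ∑ W with W.card ≤ i, X.comp ∅ W f x ^ 2 := rfl
  rw [e]
  linarith

theorem IsGammaProduct.expect_lowDegree_sq_le (hγ : 0 ≤ γ) (hX : X.IsGammaProduct γ)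
    (hγd : 3 * 64 ^ d * γ ≤ 1) (f : (∀ k, Ω k) → ℝ) (i : ℕ) :
    (X.expect fun x => X.lowDegree f i x ^ 2) ≤ 3 * X.l2 f ^ 2 := by
  have h𝒲 : ∀ W ∈ univ.filter (fun S : Finset (Fin d) => S.card ≤ i), Disjoint W ∅ :=
    fun W _ => disjoint_empty_right W
  have h1 := (abs_le.1 (hX.abs_expect_sq_sum_comp_sub_le hγ h𝒲 f)).2
  have h2 := hX.sum_expect_comp_sq_le hγ hγd h𝒲 f
  simp only [← lowDegree_eq] at h1
  have h3 : 64 ^ d * γ * X.l2 f ^ 2 ≤ 1 * X.l2 f ^ 2 := by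
    refine mul_le_mul_of_nonneg_right ?_ (sq_nonneg _)
    have : 0 ≤ 64 ^ d * γ := by positivity
    linarith
  linarith

/-- The moment bound for degrees that are small compared with `d`, where powers `q ^ (q * i)` are
at most exponential in `d * q`. -/
theorem IsGammaProduct.expect_lowDegree_pow_le (hγ : 0 ≤ γ) (hX : X.IsGammaProduct γ)
    (hγd : 3 * 64 ^ d * γ ≤ 1) {f : (∀ k, Ω k) → ℝ} {i m : ℕ} (hd : 0 < d) (hi : 0 < i)
    (hsmall : (72 * (m + 1 : ℕ) : ℝ) ^ i ≤ 4 ^ d) {M : ℝ} (hM0 : 0 ≤ M)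
    (hM : ∀ S : Finset (Fin d), S.card ≤ i → ∀ y, 0 < X.weight y →
      X.avg S (fun x => f x ^ 2) y ≤ M ^ 2) :
    (X.expect fun x => X.lowDegree f i x ^ (2 * (m + 1))) ≤
      (72 * (m + 1 : ℕ)) ^ (2 * (m + 1) * i) * (X.expect fun x => X.lowDegree f i x ^ 2) *
          M ^ (2 * m) +
        2 ^ (8 * d * (2 * (m + 1))) * γ * X.l2 f ^ 2 * M ^ (2 * m) := by
  set a : ℝ := 72 * (m + 1 : ℕ) with ha
  set β : ℝ := 2 * (12 * (m + 1 : ℕ)) ^ i with hβ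
  set N := X.l2 f with hN
  set G := X.expect fun x => X.lowDegree f i x ^ 2 with hG
  have hG0 : 0 ≤ G := X.expect_nonneg fun _ _ => sq_nonneg _
  have hβ0 : 0 ≤ β := by positivity
  have hm1 : (1 : ℝ) ≤ (m + 1 : ℕ) := by simp
  have ha1 : 1 ≤ a := by rw [ha]; linarith
  have hβa : β ≤ a ^ i := by
    have h2 : (2 : ℝ) ≤ 2 ^ i := by simpa using pow_le_pow_right₀ (one_le_two (α := ℝ)) hi
    calc β ≤ 2 ^ i * (12 * (m + 1 : ℕ)) ^ i := by
          rw [hβ]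
          gcongr
      _ = (2 * (12 * (m + 1 : ℕ))) ^ i := (mul_pow _ _ _).symm
      _ ≤ a ^ i := by
          rw [ha]
          refine pow_le_pow_left₀ (by positivity) ?_ i
          linarith
  have hβd : β ≤ 4 ^ d := hβa.trans hsmall
  have hβD : β ≤ 32 ^ d := hβd.trans (pow_le_pow_left₀ (by norm_num) (by norm_num) d)
  have h1 := hX.expect_lowDegree_pow_le_energy hγ (m := m) hM0 hM
  have h2 := hX.expect_energy_pow_le hγ hγd (m := m) hM0 hM le_rfl hβD
  have h3 := hX.expect_energy_le hγ f i
  rw [← hβ] at h2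
  rw [← ha] at h1
  rw [← hN] at h1 h2 h3
  rw [← hG] at h3
  have hak : a ^ (i * (m + 1)) ≤ 4 ^ (d * (m + 1)) := by
    rw [pow_mul, pow_mul]
    exact pow_le_pow_left₀ (by positivity) hsmall _
  have hβm : β ^ m ≤ 4 ^ (d * m) := by
    rw [pow_mul]
    exact pow_le_pow_left₀ hβ0 hβd _
  have hmain : a ^ (i * (m + 1)) * β ^ m ≤ a ^ (2 * (m + 1) * i) := by
    calc a ^ (i * (m + 1)) * β ^ m ≤ a ^ (i * (m + 1)) * (a ^ i) ^ m := by gcongr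
      _ = a ^ (i * (m + 1) + i * m) := by rw [← pow_mul, ← pow_add]
      _ ≤ _ := pow_le_pow_right₀ ha1 (by nlinarith)
  have hm2 : (m : ℝ) ≤ 2 ^ (d * m) := (natCast_le_two_pow m).trans
    (pow_le_pow_right₀ one_le_two (Nat.le_mul_of_pos_left m hd))
  -- all the error terms are powers of two with exponents of order `d * m`
  have p4 : ∀ n, (4 : ℝ) ^ n = 2 ^ (2 * n) := fun n => by rw [pow_mul]; norm_num
  have p16 : (16 : ℝ) ^ d = 2 ^ (4 * d) := by rw [pow_mul]; norm_num
  have p64 : (64 : ℝ) ^ d = 2 ^ (6 * d) := by rw [pow_mul]; norm_num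
  have p32 : ((32 : ℝ) ^ d) ^ (m + 2) = 2 ^ (5 * (d * (m + 2))) := by
    rw [← pow_mul, pow_mul 2]
    norm_num
  have herr : 4 ^ (d * (m + 1)) * (4 ^ (d * m) * 64 ^ d + 2 ^ (d * m) * (32 ^ d) ^ (m + 2)) +
      4 ^ (d * (m + 1)) * (16 ^ d * 4 ^ (d * m)) ≤ (2 : ℝ) ^ (8 * d * (2 * (m + 1))) := by
    have b : ∀ n, n + 2 ≤ 8 * d * (2 * (m + 1)) →
        (2 : ℝ) ^ n ≤ 2 ^ (8 * d * (2 * (m + 1))) / 4 := fun n hn => by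
      have := pow_le_pow_right₀ (one_le_two (α := ℝ)) hn
      rw [pow_add] at this
      linarith
    rw [p32, p4, p4, p16, p64, mul_add, ← pow_add, ← pow_add, ← pow_add, ← pow_add, ← pow_add,
      ← pow_add]
    have b1 := b (2 * (d * (m + 1)) + (2 * (d * m) + 6 * d)) (by nlinarith)
    have b2 := b (2 * (d * (m + 1)) + (d * m + 5 * (d * (m + 2)))) (by nlinarith)
    have b3 := b (2 * (d * (m + 1)) + (4 * d + 2 * (d * m))) (by nlinarith)
    have : (0 : ℝ) < 2 ^ (8 * d * (2 * (m + 1))) := by positivity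
    linarith
  calc (X.expect fun x => X.lowDegree f i x ^ (2 * (m + 1)))
      ≤ a ^ (i * (m + 1)) * ((β * M ^ 2) ^ m * (G + 64 ^ d * γ * N ^ 2) +
          m * (32 ^ d) ^ (m + 2) * M ^ (2 * m) * γ * N ^ 2) +
        4 ^ (d * (m + 1)) * (16 ^ d * 4 ^ (d * m) * γ * N ^ 2 * M ^ (2 * m)) := by
        refine h1.trans (add_le_add_left (mul_le_mul_of_nonneg_left (h2.trans ?_)
          (by positivity)) _)
        gcongr
    _ = (a ^ (i * (m + 1)) * β ^ m) * G * M ^ (2 * m) +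
        (a ^ (i * (m + 1)) * (β ^ m * 64 ^ d + m * (32 ^ d) ^ (m + 2)) +
          4 ^ (d * (m + 1)) * (16 ^ d * 4 ^ (d * m))) * γ * N ^ 2 * M ^ (2 * m) := by
        rw [mul_pow β, ← pow_mul M]
        ring
    _ ≤ a ^ (2 * (m + 1) * i) * G * M ^ (2 * m) +
        (4 ^ (d * (m + 1)) * (4 ^ (d * m) * 64 ^ d + 2 ^ (d * m) * (32 ^ d) ^ (m + 2)) +
          4 ^ (d * (m + 1)) * (16 ^ d * 4 ^ (d * m))) * γ * N ^ 2 * M ^ (2 * m) := by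
        gcongr
    _ ≤ _ := by gcongr

/-- The moment of a bounded function. -/
theorem expect_pow_le_of_abs_le {g : (∀ k, Ω k) → ℝ} {c : ℝ}
    (hg : ∀ x, 0 < X.weight x → |g x| ≤ c) (m : ℕ) :
    (X.expect fun x => g x ^ (2 * (m + 1))) ≤ c ^ (2 * m) * X.expect fun x => g x ^ 2 := by
  rw [← expect_const_mul]
  refine X.expect_mono fun x hx => ?_
  rw [mul_add, mul_one, pow_add]
  refine mul_le_mul_of_nonneg_right ?_ (sq_nonneg _)
  rw [← (even_two_mul m).pow_abs]
  exact pow_le_pow_left₀ (abs_nonneg _) (hg x hx) _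

theorem abs_lowDegree_le {f : (∀ k, Ω k) → ℝ} {i : ℕ} {M : ℝ} (hM0 : 0 ≤ M)
    (hM : ∀ S : Finset (Fin d), S.card ≤ i → ∀ y, 0 < X.weight y →
      X.avg S (fun x => f x ^ 2) y ≤ M ^ 2) {x : ∀ k, Ω k} (hx : 0 < X.weight x) :
    |X.lowDegree f i x| ≤ 4 ^ d * M := by
  rw [X.lowDegree_eq]
  calc _ ≤ ∑ S : Finset (Fin d) with S.card ≤ i, 2 ^ d * M := by
        refine (abs_sum_le_sum_abs _ _).trans (sum_le_sum fun S hS => ?_)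
        refine X.abs_comp_le hM0 hM ?_ hx
        rw [empty_union]
        exact (mem_filter.1 hS).2
    _ = (univ.filter fun S : Finset (Fin d) => S.card ≤ i).card * (2 ^ d * M) := by simp
    _ ≤ 2 ^ d * (2 ^ d * M) :=
        mul_le_mul_of_nonneg_right (card_finset_le _) (by positivity)
    _ = 4 ^ d * M := by
        rw [show (4 : ℝ) = 2 * 2 by norm_num, mul_pow]
        ring

/-- Both moment bounds, in terms of expectations. For `i = 0` the low-degree part is a constant.
If `4 ^ d ≤ (500 q) ^ i`, the trivial bound `4 ^ d * M` on its supremum suffices. -/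
theorem IsGammaProduct.expect_lowDegree_pow_le_and (hγ : 0 ≤ γ) (hX : X.IsGammaProduct γ) (m : ℕ)
    (hγd : γ ≤ 1 / 2 ^ (8 * (2 * (m + 1)) * d)) {i : ℕ} (hid : i ≤ d) {f : (∀ k, Ω k) → ℝ}
    {M : ℝ} (hM0 : 0 ≤ M)
    (hM : ∀ S : Finset (Fin d), S.card ≤ i → ∀ y, 0 < X.weight y →
      X.avg S (fun x => f x ^ 2) y ≤ M ^ 2) :
    ((X.expect fun x => X.lowDegree f i x ^ (2 * (m + 1))) ≤
      (500 * (2 * (m + 1) : ℕ)) ^ (2 * (m + 1) * i) * (X.expect fun x => X.lowDegree f i x ^ 2) *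
          M ^ (2 * m) +
        2 ^ (8 * d * (2 * (m + 1))) * γ * X.l2 f ^ 2 * M ^ (2 * m)) ∧
    (X.expect fun x => X.lowDegree f i x ^ (2 * (m + 1))) ≤
      (500 * (2 * (m + 1) : ℕ)) ^ (2 * (m + 1) * i) * X.l2 f ^ 2 * M ^ (2 * m) := by
  classical
  set b : ℝ := 500 * (2 * (m + 1) : ℕ) with hb
  set N := X.l2 f with hN
  set G := X.expect fun x => X.lowDegree f i x ^ 2 with hG
  have hG0 : 0 ≤ G := X.expect_nonneg fun _ _ => sq_nonneg _
  have hN0 : 0 ≤ N := X.l2_nonneg f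
  have hm1 : (1 : ℝ) ≤ (m + 1 : ℕ) := by simp
  have hb' : b = 1000 * (m + 1 : ℕ) := by
    rw [hb]
    push_cast
    ring
  have hb3 : 3 ≤ b := by rw [hb']; linarith
  have hE0 : 0 ≤ 2 ^ (8 * d * (2 * (m + 1))) * γ * N ^ 2 * M ^ (2 * m) := by positivity
  rcases Nat.eq_zero_or_pos i with rfl | hi
  · have hconst : ∀ x, X.lowDegree f 0 x = X.avg ∅ f x := fun x => by
      rw [X.lowDegree_eq]
      have : (univ.filter fun S : Finset (Fin d) => S.card ≤ 0) = {∅} := by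
        ext S
        simp
      rw [this, sum_singleton]
      simp [comp]
    have h := expect_pow_le_of_abs_le (X := X) (g := X.lowDegree f 0) (c := M) (fun x hx => by
      rw [hconst]
      exact abs_le_of_sq_le_sq ((X.sq_avg_le _ f hx).trans (hM ∅ (by simp) x hx)) hM0) m
    have hGN : G ≤ N ^ 2 := by
      rw [hG]
      simp only [hconst]
      rw [← l2_sq]
      exact pow_le_pow_left₀ (X.l2_nonneg _) (X.l2_avg_le ∅ f) 2
    rw [← hG] at h
    have hMm : 0 ≤ M ^ (2 * m) := pow_nonneg hM0 _
    rw [mul_zero, pow_zero, one_mul, one_mul]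
    refine ⟨by linarith, h.trans ?_⟩
    rw [mul_comm]
    gcongr
  have hd : 0 < d := hi.trans_le hid
  have hγ2 : 2 ^ (8 * d * (2 * (m + 1))) * γ ≤ 1 := by
    rw [show 8 * (2 * (m + 1)) * d = 8 * d * (2 * (m + 1)) by ring, le_div_iff₀ (by positivity)]
      at hγd
    linarith
  have hγ64 : 3 * 64 ^ d * γ ≤ 1 := by
    refine le_trans (mul_le_mul_of_nonneg_right ?_ hγ) hγ2
    calc (3 : ℝ) * 64 ^ d ≤ 2 ^ 2 * 2 ^ (6 * d) := by
          rw [pow_mul]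
          norm_num
      _ = 2 ^ (2 + 6 * d) := by rw [← pow_add]
      _ ≤ _ := pow_le_pow_right₀ one_le_two (by nlinarith)
  have hG3 : G ≤ 3 * N ^ 2 := hX.expect_lowDegree_sq_le hγ hγ64 f i
  have hqi : 2 ≤ 2 * (m + 1) * i := by nlinarith
  rcases le_or_gt (4 ^ d) (b ^ i) with hbig | hsmall
  · have h := expect_pow_le_of_abs_le (X := X) (g := X.lowDegree f i)
      (fun x hx => abs_lowDegree_le hM0 hM hx) m
    rw [← hG] at h
    have h' : (X.expect fun x => X.lowDegree f i x ^ (2 * (m + 1))) ≤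
        b ^ (2 * m * i) * M ^ (2 * m) * G := by
      refine h.trans ?_
      calc (4 ^ d * M) ^ (2 * m) * G ≤ (b ^ i * M) ^ (2 * m) * G := by gcongr
        _ = _ := by
          rw [mul_pow, ← pow_mul]
          ring
    have hb1 : b ^ (2 * m * i) * 3 ≤ b ^ (2 * (m + 1) * i) := by
      calc b ^ (2 * m * i) * 3 ≤ b ^ (2 * m * i) * b := by gcongr
        _ = b ^ (2 * m * i + 1) := by rw [pow_succ]
        _ ≤ _ := pow_le_pow_right₀ (by linarith) (by nlinarith)
    refine ⟨?_, ?_⟩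
    · have : b ^ (2 * m * i) * M ^ (2 * m) * G ≤
          b ^ (2 * (m + 1) * i) * M ^ (2 * m) * G := by
        have : 0 ≤ b ^ (2 * m * i) := by positivity
        have : b ^ (2 * m * i) ≤ b ^ (2 * (m + 1) * i) := by linarith
        exact mul_le_mul_of_nonneg_right (mul_le_mul_of_nonneg_right this (by positivity)) hG0
      linarith
    · calc _ ≤ b ^ (2 * m * i) * M ^ (2 * m) * G := h'
        _ ≤ b ^ (2 * m * i) * M ^ (2 * m) * (3 * N ^ 2) := by gcongr
        _ = (b ^ (2 * m * i) * 3) * N ^ 2 * M ^ (2 * m) := by ring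
        _ ≤ _ := by gcongr
  · set a : ℝ := 72 * (m + 1 : ℕ) with ha
    have hab : 4 * a ≤ b := by
      rw [hb', ha]
      linarith
    have ha1 : 1 ≤ a := by rw [ha]; linarith
    have h := hX.expect_lowDegree_pow_le hγ hγ64 (m := m) hd hi
      ((pow_le_pow_left₀ (by positivity) (by linarith : a ≤ b) i).trans hsmall.le) hM0 hM
    rw [← ha, ← hG, ← hN] at h
    refine ⟨h.trans ?_, h.trans ?_⟩
    · gcongr
      linarith
    · calc a ^ (2 * (m + 1) * i) * G * M ^ (2 * m) +
            2 ^ (8 * d * (2 * (m + 1))) * γ * N ^ 2 * M ^ (2 * m)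
          ≤ a ^ (2 * (m + 1) * i) * (3 * N ^ 2) * M ^ (2 * m) + 1 * N ^ 2 * M ^ (2 * m) := by
            gcongr
        _ ≤ a ^ (2 * (m + 1) * i) * (3 * N ^ 2) * M ^ (2 * m) +
            a ^ (2 * (m + 1) * i) * N ^ 2 * M ^ (2 * m) := by
            gcongr
            exact one_le_pow₀ ha1
        _ = 4 * a ^ (2 * (m + 1) * i) * N ^ 2 * M ^ (2 * m) := by ring
        _ ≤ b ^ (2 * (m + 1) * i) * N ^ 2 * M ^ (2 * m) := by
            have h4 : (4 : ℝ) ≤ 4 ^ (2 * (m + 1) * i) := by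
              simpa using pow_le_pow_right₀ (by norm_num : (1 : ℝ) ≤ 4)
                (by omega : 1 ≤ 2 * (m + 1) * i)
            gcongr
            calc 4 * a ^ (2 * (m + 1) * i) ≤ 4 ^ (2 * (m + 1) * i) * a ^ (2 * (m + 1) * i) := by
                  gcongr
              _ = (4 * a) ^ (2 * (m + 1) * i) := (mul_pow _ _ _).symm
              _ ≤ _ := pow_le_pow_left₀ (by positivity) hab _

/-! ### Link norms and `L^p` norms -/

theorem avg_sq_le_maxLinkNorm_sq (X : PartiteComplex d Ω) (f : (∀ k, Ω k) → ℝ) {i : ℕ}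
    {S : Finset (Fin d)} (hS : S.card ≤ i) {y : ∀ k, Ω k} (hy : 0 < X.weight y) :
    X.avg S (fun x => f x ^ 2) y ≤ X.maxLinkNorm f i ^ 2 := by
  rw [← X.link_expect S y hy, ← l2_sq]
  refine pow_le_pow_left₀ (l2_nonneg _ _) ?_ 2
  rw [← lpNorm_two]
  exact le_ciSup (f := fun p : {p : Finset (Fin d) × (∀ k, Ω k) //
    p.1.card ≤ i ∧ 0 < X.weight p.2} => (X.link p.1.1 p.1.2 p.2.2).lpNorm 2 f)
    (Set.finite_range _).bddAbove ⟨(S, y), hS, hy⟩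

theorem maxLinkNorm_nonneg (X : PartiteComplex d Ω) (f : (∀ k, Ω k) → ℝ) (i : ℕ) :
    0 ≤ X.maxLinkNorm f i :=
  Real.iSup_nonneg fun p => by
    rw [lpNorm_two]
    exact l2_nonneg _ _

theorem lpNorm_nonneg (X : PartiteComplex d Ω) (p : ℝ) (f : (∀ k, Ω k) → ℝ) :
    0 ≤ X.lpNorm p f :=
  Real.rpow_nonneg (X.expect_nonneg fun _ _ => Real.rpow_nonneg (abs_nonneg _) _) _

theorem lpNorm_pow_of_even (X : PartiteComplex d Ω) {q : ℕ} (hq0 : q ≠ 0) (hq : Even q)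
    (f : (∀ k, Ω k) → ℝ) : X.lpNorm q f ^ q = X.expect fun x => f x ^ q := by
  rw [lpNorm, one_div]
  rw [Real.rpow_inv_natCast_pow (X.expect_nonneg fun _ _ => Real.rpow_nonneg (abs_nonneg _) _) hq0]
  simp only [Real.rpow_natCast, hq.pow_abs]

end PartiteComplex

theorem mainTheorem3 :
    ∃ C K : ℕ, ∀ (q : ℕ), 2 ≤ q → Even q →
      ∀ (d : ℕ) (Ω : Fin d → Type*) [∀ k, Fintype (Ω k)] (X : PartiteComplex d Ω) (γ : ℝ),
        0 ≤ γ → X.IsGammaProduct γ → γ ≤ 1 / 2 ^ (C * q * d) →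
        ∀ (i : ℕ), i ≤ d → ∀ (f : (∀ k, Ω k) → ℝ),
          X.lpNorm q (X.lowDegree f i) ^ q ≤
              (500 * (q : ℝ)) ^ (q * i) * X.lpNorm 2 (X.lowDegree f i) ^ 2 *
                  X.maxLinkNorm f i ^ (q - 2) +
                ((q : ℝ) ^ (K * q * i) * 2 ^ (K * d * q)) * γ * X.lpNorm 2 f ^ 2 *
                  X.maxLinkNorm f i ^ (q - 2) ∧
          X.lpNorm q (X.lowDegree f i) ≤
            (500 * (q : ℝ)) ^ i * X.lpNorm 2 f ^ (2 / (q : ℝ)) *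
              X.maxLinkNorm f i ^ (1 - 2 / (q : ℝ)) := by
  -- the error term comes without any power of `q`, so that the factor `q ^ (K * q * i)` is slack
  refine ⟨8, 8, fun q hq2 hq d Ω _ X γ hγ hX hγd i hid f => ?_⟩
  obtain ⟨m, rfl⟩ : ∃ m, q = 2 * (m + 1) := by
    obtain ⟨r, rfl⟩ := hq
    exact ⟨r - 1, by omega⟩
  have hM0 := X.maxLinkNorm_nonneg f i
  have hN0 := X.l2_nonneg f
  obtain ⟨h1, h2⟩ := hX.expect_lowDegree_pow_le_and hγ m hγd hid hM0
    fun S hS y hy => X.avg_sq_le_maxLinkNorm_sq f hS hy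
  set M := X.maxLinkNorm f i with hM
  have hsub : 2 * (m + 1) - 2 = 2 * m := by omega
  rw [← X.lpNorm_pow_of_even (by omega) hq] at h1 h2
  rw [X.lpNorm_two, X.lpNorm_two, hsub]
  refine ⟨?_, ?_⟩
  · rw [← PartiteComplex.l2_sq] at h1
    refine h1.trans (add_le_add_right ?_ _)
    gcongr
    refine le_mul_of_one_le_left (by positivity) (one_le_pow₀ ?_)
    exact_mod_cast (by omega : 1 ≤ 2 * (m + 1))
  · have hq0 : ((2 * (m + 1) : ℕ) : ℝ) ≠ 0 := by positivity
    refine (pow_le_pow_iff_left₀ (X.lpNorm_nonneg _ _) (by positivity)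
      (by omega : 2 * (m + 1) ≠ 0)).1 (h2.trans (le_of_eq ?_))
    have eN : (X.l2 f ^ (2 / ((2 * (m + 1) : ℕ) : ℝ))) ^ (2 * (m + 1)) = X.l2 f ^ 2 := by
      rw [← Real.rpow_natCast, ← Real.rpow_mul hN0, div_mul_cancel₀ _ hq0, Real.rpow_two]
    have eM : (M ^ (1 - 2 / ((2 * (m + 1) : ℕ) : ℝ))) ^ (2 * (m + 1)) = M ^ (2 * m) := by
      rw [← Real.rpow_natCast, ← Real.rpow_mul hM0, sub_mul, div_mul_cancel₀ _ hq0,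
        ← Real.rpow_natCast]
      congr 1
      push_cast
      ring
    rw [mul_pow (_ * _) (M ^ _), mul_pow (_ ^ i) (X.l2 f ^ _), eN, eM, ← pow_mul _ i, mul_comm i]
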